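/- Setting. Let $\mathcal B$ be a unital $*$-algebra over $\mathbb C$, let $\phi:\mathcal B\to\mathbb C$ and $\gamma:\mathcal B\to\mathcal B$ be linear maps commuting with the involutions and $\Lambda:\mathcal B\otimes\mathcal B\to\mathcal B$ a linear map, such that $\phi$ is positive and faithful and $\psi:=\gamma+\phi(\cdot)1$ is completely positive (an element is positive if it is a finite sum of elements $u^*u$). Assume, for all $b,u,v\in\mathcal B$, $$\phi[v^*\Lambda(b\otimes u)]=\phi[\Lambda(b^*\otimes v)^*u],\qquad \gamma[v^*\Lambda(b\otimes u)]=\gamma[\Lambda(b^*\otimes v)^*u].$$ Let $\mathcal F_{alg}=\mathbb C\Omega\oplus\bigoplus_{n\ge1}\mathcal B^{\otimes n}$ carry the semi-inner product for which $\Omega$ is a unit vector, tensors of different degrees are orthogonal, and $$\langle u_1\otimes\dots\otimes u_n,v_1\otimes\dots\otimes v_n\rangle=\phi\big[v_n^*\psi[v_{n-1}^*\psi[\cdots\psi[v_1^*u_1]\cdots]u_{n-1}]u_n\big],$$ and let $\mathcal F$ be the completion of the quotient of $\mathcal F_{alg}$ by the vectors of zero seminorm. On $\mathcal F_{alg}$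 put $X(b)=a^+(b)+a^-(b)+a^0(b)$, where $a^+(b)\xi=b\otimes\xi$ (so $a^+(b)\Omega=b$), $a^-(b)(u_1\otimes\dots\otimes u_n)=\psi[bu_1]u_2\otimes u_3\otimes\dots\otimes u_n$ for $n\ge2$, $a^-(b)u_1=\phi[bu_1]\Omega$, $a^0(b)(u_1\otimes\dots\otimes u_n)=\Lambda(b\otimes u_1)\otimes u_2\otimes\dots\otimes u_n$, $a^-(b)\Omega=a^0(b)\Omega=0$. Let $S$ be the antilinear involution $S(u_1\otimes\dots\otimes u_n)=u_n^*\otimes\dots\otimes u_1^*$ of $\mathcal F_{alg}$ (with $S\Omega=\Omega$), and $X_r(u)=S\,X(u^*)\,S$. The Wick polynomials are $W(\emptyset)=I$, $W(u)=X(u)$, $W(u,v)=X(u)X(v)-X(\Lambda(u\otimes v))-\phi[uv]$ and, for $n\ge 2$, $W(u_0,\dots,u_n)=X(u_0)W(u_1,\dots,u_n)-W(\Lambda(u_0\otimes u_1),u_2,\dots,u_n)-W(\psi[u_0u_1]u_2,u_3,\dots,u_n)$; write $W(u_1\otimes\dots\otimes u_n)$ for $W(u_1,\dots,u_n)$. Theorem.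 Suppose that all $X(u)$, $u\in\mathcal B$, are bounded for the seminorm; denote their extensions to $\mathcal F$ again by $X(u)$ and let $\Gamma=W^*(X(u):u\in\mathcal B)$. Then $\Gamma=W^*(X(u):u\in\mathcal B^{sa})$. Consider the conditions (for all $u,v,y,z\in\mathcal B$) 1. $\Lambda(v^*\otimes u^*)^*=\Lambda(u\otimes v)$; 2. $u\,\gamma[yv]-\gamma[uy]\,v=\Lambda(u\otimes\Lambda(y\otimes v))-\Lambda(\Lambda(u\otimes y)\otimes v)$; 3. $\Lambda(u\otimes y\gamma[zv])-\Lambda(u\otimes y)\gamma[zv]=\Lambda(\gamma[uy]z\otimes v)-\gamma[uy]\Lambda(z\otimes v)$; 4. $\phi[\gamma[u]v]=\phi[u\gamma[v]]$. Say that the right operators commute with $\Gamma$ if each $X_r(u)$, with domain $\mathcal F_{alg}$, commutes with the generators of $\Gamma$, that is, $X_r(u)X(v)\xi=X(v)X_r(u)\xi$ in $\mathcal F$ for all $u,v\in\mathcal B$ and $\xi\in\mathcal F_{alg}$. (a) The right operators commute with $\Gamma$ if and only if 1–4 hold. In this case, for all $u\in\mathcal B$ and $A\in\Gamma$, the closure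 in $\mathcal F\times\mathcal F$ of the graph of $X_r(u)$ is mapped into itself by $A\times A$; conversely, if each $X_r(u)$ is a well-defined closable operator in $\mathcal F$ (for example, bounded) and the closures of the graphs are so mapped for all $u$ and all $A\in\Gamma$ (that is, the closure of each $X_r(u)$ commutes with $\Gamma$), then the right operators commute with $\Gamma$ in the above sense. If $\gamma$ is scalar-valued, 3 holds automatically. (b) If $\phi$ is tracial and the right operators commute with $\Gamma$, then the vacuum state $A\mapsto\langle A\Omega,\Omega\rangle$ is tracial on $\Gamma$. (c) If the vacuum state is tracial on $\Gamma$, then 1, 2 and 3 hold. Under the assumptions in (b): $S$ extends to an antiunitary operator $J$ on $\mathcal F$, the vector $\Omega$ is cyclic and separating for $\Gamma$, and $J$ is the modular conjugation of $(\Gamma,\Omega)$; $W(u_1\otimes\dots\otimes u_n)^*=W(u_n^*\otimes\dots\otimes u_1^*)$ for all $u_1,\dots,u_n\in\mathcal B$; each $X_r(u)$ is bounded, and its extension to $\mathcal F$ satisfies $X_r(u)^*=X_r(u^*)$; and the canonical map $A\mapsto JA^*J$ is a $*$-anti-isomorphism of $\Gamma$ onto its commutant $\Gamma'$ that maps $X(u)$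 to $X_r(u)$ for every $u\in\mathcal B$. -/

import Mathlib

open scoped TensorProduct DirectSum ComplexConjugate

noncomputable section

set_option linter.unusedSectionVars false

/-! ### Positivity in star-algebras -/

/-- An element of a star-ring is positive if it is a finite sum of elements `star u * u`. -/
def IsStarPositive {R : Type*} [Ring R] [StarRing R] (b : R) : Prop :=
  b ∈ AddSubmonoid.closure {x : R | ∃ u : R, x = star u * u}

/-- A map is positive if it maps each `star u * u` to a positive element. -/
def IsPositiveMap {R S : Type*} [Ring R] [StarRing R] [Ring S] [StarRing S] (T : R → S) : Prop :=
  ∀ u : R, IsStarPositive (T (star u * u))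

/-- A map is completely positive if all its entrywise amplifications to matrices are positive. -/
def IsCompletelyPositive {R S : Type*} [Ring R] [StarRing R] [Ring S] [StarRing S]
    (T : R → S) : Prop :=
  ∀ n : ℕ, IsPositiveMap
    (fun A : Matrix (Fin n) (Fin n) R => (A.map T : Matrix (Fin n) (Fin n) S))

/-! ### The data of the construction -/

/-- The data: star-linear maps `phi : B → ℂ`, `gamma : B → B` and a bilinear map `Lambda`
(a linear map on `B ⊗ B`), such that `phi` is positive and faithful, `gamma + phi` is completely
positive, and the standing symmetry hypothesis on `Lambda` holds. -/
structure FockData (B : Type*) [Ring B] [StarRing B] [Algebra ℂ B] [StarModule ℂ B] where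
  phi : B →ₗ[ℂ] ℂ
  gamma : B →ₗ[ℂ] B
  Lambda : B →ₗ[ℂ] B →ₗ[ℂ] B
  phi_star : ∀ u, phi (star u) = conj (phi u)
  gamma_star : ∀ u, gamma (star u) = star (gamma u)
  phi_positive : IsPositiveMap phi
  phi_faithful : ∀ u, phi (star u * u) = 0 → u = 0
  gamma_add_phi_cp : IsCompletelyPositive (fun b : B => gamma b + algebraMap ℂ B (phi b))
  phi_Lambda : ∀ b u v,
    phi (star v * Lambda b u) = phi (star (Lambda (star b) v) * u)
  gamma_Lambda : ∀ b u v,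
    gamma (star v * Lambda b u) = gamma (star (Lambda (star b) v) * u)

/-! ### The algebraic Fock space -/

/-- The algebraic Fock space, the direct sum of the tensor powers of `B`; the summand of degree `0`
is spanned by the vacuum vector, the empty tensor. -/
abbrev AlgFock (B : Type*) [Ring B] [Algebra ℂ B] : Type _ := ⨁ n : ℕ, ⨂[ℂ]^n B

namespace AlgFock

variable {B : Type*} [Ring B] [Algebra ℂ B]

/-- The simple tensor `u 0 ⊗ u 1 ⊗ ... ⊗ u (n - 1)`. -/
def simple (B : Type*) [Ring B] [Algebra ℂ B] (n : ℕ) :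
    MultilinearMap ℂ (fun _ : Fin n => B) (AlgFock B) :=
  (DirectSum.lof ℂ ℕ (fun n => ⨂[ℂ]^n B) n).compMultilinearMap (PiTensorProduct.tprod ℂ)

/-- The vacuum vector. -/
def vac : AlgFock B := simple B 0 Fin.elim0

/-- The linear map on the algebraic Fock space with prescribed values on simple tensors. -/
def lift {E : Type*} [AddCommGroup E] [Module ℂ E]
    (f : ∀ n : ℕ, MultilinearMap ℂ (fun _ : Fin n => B) E) : AlgFock B →ₗ[ℂ] E :=
  DirectSum.toModule ℂ ℕ E (fun n => PiTensorProduct.lift (f n))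

theorem lift_simple {E : Type*} [AddCommGroup E] [Module ℂ E]
    (f : ∀ n : ℕ, MultilinearMap ℂ (fun _ : Fin n => B) E) (n : ℕ) (u : Fin n → B) :
    lift f (simple B n u) = f n u := by
  simp [lift, simple]

theorem induction {p : AlgFock B → Prop} (x : AlgFock B)
    (hs : ∀ (c : ℂ) (n : ℕ) (u : Fin n → B), p (c • simple B n u))
    (h0 : p 0) (ha : ∀ x y, p x → p y → p (x + y)) : p x := by
  induction x using DirectSum.induction_on with
  | zero => exact h0
  | add x y hx hy => exact ha x y hx hy
  | of n t =>
    induction t using PiTensorProduct.induction_on with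
    | smul_tprod c u =>
      have := hs c n u
      rw [simple, LinearMap.compMultilinearMap_apply, ← map_smul] at this
      exact this
    | add s t hs ht => rw [map_add]; exact ha _ _ hs ht

section Star
variable [StarRing B] [StarModule ℂ B]

theorem star_update {n : ℕ} [DecidableEq (Fin n)] (f : Fin n → B) (i : Fin n) (a : B) :
    (fun j => star (Function.update f i a j))
      = Function.update (fun j => star (f j)) i (star a) := by
  funext j
  by_cases h : j = i
  · subst h; simp
  · simp [h]

/-- Auxiliary: the factorwise star on one tensor power. -/
def conjAux (n : ℕ) : (⨂[ℂ]^n B) →+ AlgFock B :=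
  PiTensorProduct.liftAddHom
    (fun p : ℂ × (Fin n → B) => conj p.1 • simple B n (fun i => star (p.2 i)))
    (fun z f i hf => by
      have : simple B n (fun j => star (f j)) = 0 :=
        MultilinearMap.map_coord_zero _ i (by simp [hf])
      simp [this])
    (fun f => by simp)
    (fun z f i a b => by
      simp only [star_update, star_add, MultilinearMap.map_update_add, smul_add])
    (fun z z' f => by simp [add_smul])
    (fun z f i r => by
      have : Function.update (fun j => star (f j)) i (star (f i)) = fun j => star (f j) :=
        Function.update_eq_self i _
      simp only [star_update, star_smul, MultilinearMap.map_update_smul, smul_smul, map_mul, this]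
      congr 1
      exact mul_comm _ _)

theorem conjAux_smul (n : ℕ) (c : ℂ) (t : ⨂[ℂ]^n B) :
    conjAux n (c • t) = conj c • conjAux n t := by
  induction t using PiTensorProduct.induction_on' with
  | tprodCoeff r f =>
    rw [PiTensorProduct.smul_tprodCoeff']
    change conj (c • r) • simple B n (fun i => star (f i))
      = conj c • (conj r • simple B n (fun i => star (f i)))
    simp [smul_smul]
  | add x y hx hy => rw [smul_add, map_add, map_add, hx, hy, smul_add]

theorem conjAux_tprod (n : ℕ) (u : Fin n → B) :
    conjAux n (PiTensorProduct.tprod ℂ u) = simple B n (fun i => star (u i)) := by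
  rw [PiTensorProduct.tprod_eq_tprodCoeff_one]
  change conj (1 : ℂ) • simple B n (fun i => star (u i)) = _
  simp

/-- The factorwise star, the antilinear map
`u 0 ⊗ ... ⊗ u (n - 1) ↦ star (u 0) ⊗ ... ⊗ star (u (n - 1))`. -/
def conjMap (B : Type*) [Ring B] [Algebra ℂ B] [StarRing B] [StarModule ℂ B] :
    AlgFock B →ₛₗ[starRingEnd ℂ] AlgFock B where
  toFun := DirectSum.toAddMonoid (fun n => conjAux n)
  map_add' := map_add _
  map_smul' := by
    intro c x
    induction x using DirectSum.induction_on with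
    | zero => simp
    | add x y hx hy => rw [smul_add, map_add, map_add, hx, hy, smul_add]
    | of n t =>
      rw [← DirectSum.of_smul, DirectSum.toAddMonoid_of, DirectSum.toAddMonoid_of, conjAux_smul]

theorem conjMap_simple (n : ℕ) (u : Fin n → B) :
    conjMap B (simple B n u) = simple B n (fun i => star (u i)) :=
  (DirectSum.toAddMonoid_of _ _ _).trans (conjAux_tprod n u)

/-- The reversal `u 0 ⊗ ... ⊗ u (n - 1) ↦ u (n - 1) ⊗ ... ⊗ u 0`. -/
def flip : AlgFock B →ₗ[ℂ] AlgFock B :=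
  lift fun n => (simple B n).domDomCongr Fin.revPerm

/-- The antilinear involution `S`,
`S (u 0 ⊗ ... ⊗ u (n - 1)) = star (u (n - 1)) ⊗ ... ⊗ star (u 0)`. -/
def S (B : Type*) [Ring B] [Algebra ℂ B] [StarRing B] [StarModule ℂ B] :
    AlgFock B →ₛₗ[starRingEnd ℂ] AlgFock B :=
  flip.comp (conjMap B)

theorem S_simple (n : ℕ) (u : Fin n → B) :
    S B (simple B n u) = simple B n (fun i => star (u i.rev)) := by
  rw [S, LinearMap.comp_apply, conjMap_simple, flip, lift_simple]
  rfl

end Star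
end AlgFock

namespace FockData

open AlgFock

variable {B : Type*} [Ring B] [StarRing B] [Algebra ℂ B] [StarModule ℂ B] (D : FockData B)

/-- The map `gamma + phi`. -/
def psi : B →ₗ[ℂ] B := D.gamma + (Algebra.linearMap ℂ B).comp D.phi

theorem psi_apply (b : B) : D.psi b = D.gamma b + algebraMap ℂ B (D.phi b) := rfl

theorem psi_star (b : B) : D.psi (star b) = star (D.psi b) := by
  rw [psi_apply, psi_apply, D.gamma_star, D.phi_star, star_add, ← algebraMap_star_comm]
  rfl

/-! ### The operators on the algebraic Fock space -/

/-- The creation operator `b ⊗ ·`. -/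
def creation (b : B) : AlgFock B →ₗ[ℂ] AlgFock B :=
  lift fun n => (simple B (n + 1)).curryLeft b

/-- The preservation operator `a⁰(b)`. -/
def preservation (b : B) : AlgFock B →ₗ[ℂ] AlgFock B :=
  lift fun n => match n with
    | 0 => 0
    | n + 1 => ((simple B (n + 1)).curryLeft.comp (D.Lambda b)).uncurryLeft

/-- The annihilation operator `a⁻(b)`. -/
def annihilation (b : B) : AlgFock B →ₗ[ℂ] AlgFock B :=
  lift fun n => match n with
    | 0 => 0
    | 1 => MultilinearMap.ofSubsingleton ℂ B (AlgFock B) (0 : Fin 1)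
        ((D.phi.comp (LinearMap.mulLeft ℂ b)).smulRight vac)
    | n + 2 => LinearMap.uncurryLeft
        ((multilinearCurryLeftEquiv ℂ (fun _ : Fin (n + 1) => B) (AlgFock B)).symm.toLinearMap.comp
          (((LinearMap.mul ℂ B).comp (D.psi.comp (LinearMap.mulLeft ℂ b))).compr₂
            (simple B (n + 1)).curryLeft))

/-- `X(b) = a⁺(b) + a⁻(b) + a⁰(b)`. -/
def X (b : B) : AlgFock B →ₗ[ℂ] AlgFock B :=
  creation b + D.annihilation b + D.preservation b

/-- The right operator `X_r(b) = S X(S b) S`. -/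
def Xr (b : B) : AlgFock B →ₗ[ℂ] AlgFock B :=
  (S B).comp ((D.X (star b)).comp (S B))

theorem creation_simple (b : B) (n : ℕ) (u : Fin n → B) :
    creation b (simple B n u) = simple B (n + 1) (Fin.cons b u) := by
  rw [creation, lift_simple]; rfl

theorem preservation_vac (b : B) : D.preservation b vac = 0 := by
  rw [preservation, vac, lift_simple]; rfl

theorem preservation_simple (b : B) (n : ℕ) (u₀ : B) (u : Fin n → B) :
    D.preservation b (simple B (n + 1) (Fin.cons u₀ u))
      = simple B (n + 1) (Fin.cons (D.Lambda b u₀) u) := by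
  rw [preservation, lift_simple]; rfl

theorem annihilation_vac (b : B) : D.annihilation b vac = 0 := by
  rw [annihilation, vac, lift_simple]; rfl

theorem annihilation_simple_one (b u₀ : B) :
    D.annihilation b (simple B 1 (fun _ => u₀)) = D.phi (b * u₀) • vac := by
  rw [annihilation, lift_simple]; rfl

theorem annihilation_simple (b : B) (n : ℕ) (u₀ u₁ : B) (u : Fin n → B) :
    D.annihilation b (simple B (n + 2) (Fin.cons u₀ (Fin.cons u₁ u : Fin (n + 1) → B)))
      = simple B (n + 1) (Fin.cons (D.psi (b * u₀) * u₁) u) := by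
  rw [annihilation, lift_simple]; rfl

/-! ### The inner product -/

/-- `psi[w_n psi[w_{n-1} ... psi[w_1 u_1] ... u_{n-1}] u_n]`, and `1` if `n = 0`. -/
def nest : ∀ n : ℕ, (Fin n → B) → (Fin n → B) → B
  | 0, _, _ => 1
  | n + 1, w, u => D.psi (w (Fin.last n)
      * nest n (fun i => w i.castSucc) (fun i => u i.castSucc) * u (Fin.last n))

/-- `phi[w_n psi[w_{n-1} ... psi[w_1 u_1] ... u_{n-1}] u_n]`, and `1` if `n = 0`. -/
def wordForm : ∀ n : ℕ, (Fin n → B) → (Fin n → B) → ℂ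
  | 0, _, _ => 1
  | n + 1, w, u => D.phi (w (Fin.last n)
      * D.nest n (fun i => w i.castSucc) (fun i => u i.castSucc) * u (Fin.last n))

theorem update_castSucc {n : ℕ}
    (f : Fin (n + 1) → B) (j : Fin n) (a : B) :
    (fun i : Fin n => Function.update f j.castSucc a i.castSucc)
      = Function.update (fun i => f i.castSucc) j a := by
  funext i
  by_cases h : i = j
  · subst h; simp
  · rw [Function.update_of_ne h, Function.update_of_ne (fun h' => h (Fin.castSucc_injective n h'))]

theorem update_castSucc_last {n : ℕ}
    (f : Fin (n + 1) → B) (j : Fin n) (a : B) :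
    Function.update f j.castSucc a (Fin.last n) = f (Fin.last n) :=
  Function.update_of_ne (Fin.castSucc_lt_last j).ne' _ _

theorem nest_add_right (n : ℕ) (w u : Fin n → B) (i : Fin n) (a b : B) :
    D.nest n w (Function.update u i (a + b))
      = D.nest n w (Function.update u i a) + D.nest n w (Function.update u i b) := by
  induction n with
  | zero => exact i.elim0
  | succ n ih =>
    induction i using Fin.lastCases with
    | last => simp [nest, mul_add]
    | cast j => simp [nest, update_castSucc, update_castSucc_last, ih, mul_add, add_mul]

theorem nest_smul_right (n : ℕ) (w u : Fin n → B) (i : Fin n) (c : ℂ)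
    (a : B) :
    D.nest n w (Function.update u i (c • a)) = c • D.nest n w (Function.update u i a) := by
  induction n with
  | zero => exact i.elim0
  | succ n ih =>
    induction i using Fin.lastCases with
    | last => simp [nest]
    | cast j => simp [nest, update_castSucc, update_castSucc_last, ih]

theorem nest_add_left (n : ℕ) (w u : Fin n → B) (i : Fin n) (a b : B) :
    D.nest n (Function.update w i (a + b)) u
      = D.nest n (Function.update w i a) u + D.nest n (Function.update w i b) u := by
  induction n with
  | zero => exact i.elim0
  | succ n ih =>
    induction i using Fin.lastCases with
    | last => simp [nest, add_mul]
    | cast j => simp [nest, update_castSucc, update_castSucc_last, ih, mul_add, add_mul]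

theorem nest_smul_left (n : ℕ) (w u : Fin n → B) (i : Fin n) (c : ℂ)
    (a : B) :
    D.nest n (Function.update w i (c • a)) u = c • D.nest n (Function.update w i a) u := by
  induction n with
  | zero => exact i.elim0
  | succ n ih =>
    induction i using Fin.lastCases with
    | last => simp [nest]
    | cast j => simp [nest, update_castSucc, update_castSucc_last, ih]

/-- `wordForm` as a multilinear map of its second argument. -/
def wordFormRight (n : ℕ) (w : Fin n → B) : MultilinearMap ℂ (fun _ : Fin n => B) ℂ where
  toFun u := D.wordForm n w u
  map_update_add' := by
    intro inst u i a b
    obtain rfl : inst = instDecidableEqFin n := Subsingleton.elim _ _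
    cases n with
    | zero => exact i.elim0
    | succ n =>
        induction i using Fin.lastCases with
      | last => simp [wordForm, mul_add]
      | cast j =>
        simp [wordForm, update_castSucc, update_castSucc_last, nest_add_right, mul_add, add_mul]
  map_update_smul' := by
    intro inst u i c a
    obtain rfl : inst = instDecidableEqFin n := Subsingleton.elim _ _
    cases n with
    | zero => exact i.elim0
    | succ n =>
        induction i using Fin.lastCases with
      | last => simp [wordForm]
      | cast j => simp [wordForm, update_castSucc, update_castSucc_last, nest_smul_right]

/-- `wordForm` as a multilinear map of its first argument, with values in functionals on the
algebraic Fock space that vanish on the tensors of any other degree. -/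
def wordFormMulti (n : ℕ) : MultilinearMap ℂ (fun _ : Fin n => B) (AlgFock B →ₗ[ℂ] ℂ) where
  toFun w := (PiTensorProduct.lift (D.wordFormRight n w)).comp
    (DirectSum.component ℂ ℕ (fun n => ⨂[ℂ]^n B) n)
  map_update_add' := by
    intro inst w i a b
    obtain rfl : inst = instDecidableEqFin n := Subsingleton.elim _ _
    rw [← LinearMap.add_comp, ← map_add]
    congr 2
    ext u
    cases n with
    | zero => exact i.elim0
    | succ n =>
        induction i using Fin.lastCases with
      | last => simp [wordFormRight, wordForm, add_mul]
      | cast j =>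
        simp [wordFormRight, wordForm, update_castSucc, update_castSucc_last, nest_add_left,
          mul_add, add_mul]
  map_update_smul' := by
    intro inst w i c a
    obtain rfl : inst = instDecidableEqFin n := Subsingleton.elim _ _
    rw [← LinearMap.smul_comp, ← map_smul]
    congr 2
    ext u
    cases n with
    | zero => exact i.elim0
    | succ n =>
        induction i using Fin.lastCases with
      | last => simp [wordFormRight, wordForm]
      | cast j =>
        simp [wordFormRight, wordForm, update_castSucc, update_castSucc_last, nest_smul_left]

/-- The inner product, linear in the first and conjugate-linear in the second argument. -/
def ip (x y : AlgFock B) : ℂ := lift D.wordFormMulti (conjMap B y) x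

theorem ip_simple (n : ℕ) (u v : Fin n → B) :
    D.ip (simple B n u) (simple B n v) = D.wordForm n (fun i => star (v i)) u := by
  rw [ip, conjMap_simple, lift_simple]
  simp [wordFormMulti, wordFormRight, simple]

theorem ip_simple_of_ne {n m : ℕ} (h : n ≠ m) (u : Fin n → B) (v : Fin m → B) :
    D.ip (simple B n u) (simple B m v) = 0 := by
  rw [ip, conjMap_simple, lift_simple]
  simp [wordFormMulti, simple, DirectSum.component.of, h]

theorem ip_add_left (x y z : AlgFock B) : D.ip (x + y) z = D.ip x z + D.ip y z := by
  simp [ip]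

theorem ip_add_right (x y z : AlgFock B) : D.ip x (y + z) = D.ip x y + D.ip x z := by
  simp [ip]

theorem ip_smul_left (c : ℂ) (x y : AlgFock B) : D.ip (c • x) y = c * D.ip x y := by
  simp [ip]

theorem ip_smul_right (c : ℂ) (x y : AlgFock B) : D.ip x (c • y) = conj c * D.ip x y := by
  simp [ip]

theorem ip_zero_left (x : AlgFock B) : D.ip 0 x = 0 := by simp [ip]

theorem ip_zero_right (x : AlgFock B) : D.ip x 0 = 0 := by simp [ip]

theorem nest_star (n : ℕ) (w u : Fin n → B) :
    star (D.nest n w u) = D.nest n (fun i => star (u i)) (fun i => star (w i)) := by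
  induction n with
  | zero => simp [nest]
  | succ n ih => simp [nest, ← psi_star, ih, mul_assoc]

theorem wordForm_star (n : ℕ) (u v : Fin n → B) :
    conj (D.wordForm n (fun i => star (v i)) u) = D.wordForm n (fun i => star (u i)) v := by
  cases n with
  | zero => simp [wordForm]
  | succ n => simp [wordForm, ← phi_star, nest_star, mul_assoc]

theorem conj_ip (x y : AlgFock B) : conj (D.ip x y) = D.ip y x := by
  induction x using AlgFock.induction with
  | h0 => simp [ip_zero_left, ip_zero_right]
  | ha x x' hx hx' => simp [ip_add_left, ip_add_right, hx, hx']
  | hs c n u =>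
    induction y using AlgFock.induction with
    | h0 => simp [ip_zero_left, ip_zero_right]
    | ha y y' hy hy' => rw [ip_add_left, ip_add_right, map_add, hy, hy']
    | hs d m v =>
      simp only [ip_smul_left, ip_smul_right, map_mul, Complex.conj_conj]
      by_cases h : n = m
      · subst h
        rw [ip_simple, ip_simple, wordForm_star]
        ring
      · rw [ip_simple_of_ne D h, ip_simple_of_ne D (Ne.symm h)]
        simp

theorem psi_map_positive {k : ℕ} {P : Matrix (Fin k) (Fin k) B} (hP : IsStarPositive P) :
    IsStarPositive (P.map D.psi) := by
  induction hP using AddSubmonoid.closure_induction with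
  | mem x hx =>
    obtain ⟨A, rfl⟩ := hx
    exact D.gamma_add_phi_cp k A
  | zero =>
    have : ((0 : Matrix (Fin k) (Fin k) B).map D.psi) = 0 := by ext; simp
    rw [this]; exact AddSubmonoid.zero_mem _
  | add x y _ _ hx hy =>
    have : (x + y).map D.psi = x.map D.psi + y.map D.psi := by ext; simp
    rw [this]; exact AddSubmonoid.add_mem _ hx hy

theorem conj_positive {k : ℕ} {P : Matrix (Fin k) (Fin k) B} (hP : IsStarPositive P)
    (d : Fin k → B) :
    IsStarPositive (Matrix.of fun i j => star (d i) * P i j * d j) := by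
  have key : ∀ P : Matrix (Fin k) (Fin k) B,
      (Matrix.of fun i j => star (d i) * P i j * d j)
        = star (Matrix.diagonal d) * P * Matrix.diagonal d := by
    intro P
    ext i j
    simp [Matrix.star_eq_conjTranspose, Matrix.diagonal_conjTranspose]
  rw [key]
  induction hP using AddSubmonoid.closure_induction with
  | mem x hx =>
    obtain ⟨A, rfl⟩ := hx
    exact AddSubmonoid.subset_closure ⟨A * Matrix.diagonal d, by simp [mul_assoc]⟩
  | zero => rw [mul_zero, zero_mul]; exact AddSubmonoid.zero_mem _
  | add x y _ _ hx hy => rw [mul_add, add_mul]; exact AddSubmonoid.add_mem _ hx hy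

theorem one_positive (k : ℕ) :
    IsStarPositive (Matrix.of fun _ _ : Fin k => (1 : B)) := by
  cases k with
  | zero =>
    rw [Subsingleton.elim (Matrix.of fun _ _ : Fin 0 => (1 : B)) 0]
    exact AddSubmonoid.zero_mem _
  | succ k =>
    refine AddSubmonoid.subset_closure ⟨Matrix.of fun i _ => if i = 0 then 1 else 0, ?_⟩
    ext i j
    simp [Matrix.mul_apply, Matrix.star_apply]

theorem nest_positive {k : ℕ} (n : ℕ) (u : Fin k → Fin n → B) :
    IsStarPositive (Matrix.of fun i j : Fin k => D.nest n (fun l => star (u i l)) (u j)) := by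
  induction n with
  | zero => exact one_positive k
  | succ n ih =>
    exact D.psi_map_positive
      (conj_positive (ih (fun i l => u i l.castSucc)) (fun i => u i (Fin.last n)))

theorem phi_nonneg (b : B) : 0 ≤ (D.phi (star b * b)).re := by
  have h := D.phi_positive b
  generalize D.phi (star b * b) = z at h
  change z ∈ AddSubmonoid.closure _ at h
  induction h using AddSubmonoid.closure_induction with
  | mem x hx =>
    obtain ⟨z, rfl⟩ := hx
    simp only [Complex.star_def, Complex.mul_re, Complex.conj_re, Complex.conj_im]
    nlinarith [mul_self_nonneg z.re, mul_self_nonneg z.im]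
  | zero => simp
  | add x y _ _ hx hy => simpa using add_nonneg hx hy

theorem phi_sum_nonneg {k : ℕ} {P : Matrix (Fin k) (Fin k) B} (hP : IsStarPositive P)
    (d : Fin k → B) :
    0 ≤ (D.phi (∑ i, ∑ j, star (d i) * P i j * d j)).re := by
  induction hP using AddSubmonoid.closure_induction with
  | mem x hx =>
    obtain ⟨A, rfl⟩ := hx
    have : ∑ i, ∑ j, star (d i) * (star A * A) i j * d j
        = ∑ r, star (∑ j, A r j * d j) * ∑ j, A r j * d j := by
      simp only [Matrix.mul_apply, Matrix.star_apply, star_sum, star_mul, Finset.sum_mul,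
        Finset.mul_sum, mul_assoc]
      rw [Finset.sum_comm]
      conv_rhs => rw [Finset.sum_comm]; enter [2, i]; rw [Finset.sum_comm]
    rw [this, map_sum, Complex.re_sum]
    exact Finset.sum_nonneg fun r _ => D.phi_nonneg _
  | zero => simp
  | add x y _ _ hx hy =>
    simp only [Matrix.add_apply, mul_add, add_mul, Finset.sum_add_distrib, map_add, Complex.add_re]
    exact add_nonneg hx hy

theorem exists_sum (n : ℕ) (t : ⨂[ℂ]^n B) : ∃ (k : ℕ) (c : Fin k → ℂ) (u : Fin k → Fin n → B),
    t = ∑ i, c i • PiTensorProduct.tprod ℂ (u i) := by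
  have ht : t ∈ Submodule.span ℂ (Set.range (PiTensorProduct.tprod ℂ (s := fun _ : Fin n => B))) := by
    rw [PiTensorProduct.span_tprod_eq_top]; trivial
  rw [Finsupp.mem_span_range_iff_exists_finsupp] at ht
  obtain ⟨f, rfl⟩ := ht
  refine ⟨f.support.card, fun i => f (f.support.equivFin.symm i),
    fun i => (f.support.equivFin.symm i : Fin n → B), ?_⟩
  rw [Finsupp.sum, ← Finset.sum_coe_sort,
    ← Equiv.sum_comp f.support.equivFin.symm
      (fun i : f.support => f i • PiTensorProduct.tprod ℂ (i : Fin n → B))]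

theorem ip_sum_sum {k : ℕ} (c : Fin k → ℂ) (x : Fin k → AlgFock B) :
    D.ip (∑ i, c i • x i) (∑ i, c i • x i)
      = ∑ i, ∑ j, conj (c i) * c j * D.ip (x j) (x i) := by
  have h1 : ∀ y : AlgFock B, D.ip (∑ i, c i • x i) y = ∑ i, c i * D.ip (x i) y := by
    intro y; simp [ip, map_sum]
  have h2 : ∀ y : AlgFock B, D.ip y (∑ i, c i • x i) = ∑ i, conj (c i) * D.ip y (x i) := by
    intro y; simp [ip, map_sum]
  rw [h2]
  simp only [h1, Finset.mul_sum, mul_assoc]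

theorem ip_lof_nonneg (n : ℕ) (t : ⨂[ℂ]^n B) :
    0 ≤ (D.ip (DirectSum.of (fun n => ⨂[ℂ]^n B) n t)
      (DirectSum.of (fun n => ⨂[ℂ]^n B) n t)).re := by
  obtain ⟨k, c, u, rfl⟩ := exists_sum n t
  have h : (DirectSum.of (fun n => ⨂[ℂ]^n B) n) (∑ i, c i • PiTensorProduct.tprod ℂ (u i))
      = ∑ i, c i • simple B n (u i) := by
    change DirectSum.lof ℂ ℕ (fun n => ⨂[ℂ]^n B) n _ = _
    simp [map_sum, simple]
  rw [h, ip_sum_sum]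
  simp only [ip_simple]
  cases n with
  | zero =>
    have : ∑ i, ∑ j, conj (c i) * c j * D.wordForm 0 (fun l => star (u i l)) (u j)
        = conj (∑ i, c i) * ∑ j, c j := by
      simp only [wordForm, mul_one, map_sum]
      exact (Fintype.sum_mul_sum (fun i => conj (c i)) c).symm
    rw [this, ← Complex.normSq_eq_conj_mul_self]
    simpa using Complex.normSq_nonneg _
  | succ n =>
    have := D.phi_sum_nonneg (D.nest_positive n (fun i l => u i l.castSucc))
      (fun i => c i • u i (Fin.last n))
    convert this using 2
    simp [wordForm, map_sum, smul_smul, mul_comm]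

theorem ip_of_of_ne {n m : ℕ} (h : n ≠ m) (s : ⨂[ℂ]^n B) (t : ⨂[ℂ]^m B) :
    D.ip (DirectSum.of (fun n => ⨂[ℂ]^n B) n s) (DirectSum.of (fun n => ⨂[ℂ]^n B) m t) = 0 := by
  induction s using PiTensorProduct.induction_on with
  | add s s' hs hs' => rw [map_add, ip_add_left, hs, hs', add_zero]
  | smul_tprod c u =>
    induction t using PiTensorProduct.induction_on with
    | add t t' ht ht' => rw [map_add, ip_add_right, ht, ht', add_zero]
    | smul_tprod d v =>
      change D.ip (DirectSum.lof ℂ ℕ (fun n => ⨂[ℂ]^n B) n _)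
        (DirectSum.lof ℂ ℕ (fun n => ⨂[ℂ]^n B) m _) = 0
      rw [map_smul, map_smul, ip_smul_left, ip_smul_right]
      have := D.ip_simple_of_ne h u v
      simp only [simple, LinearMap.compMultilinearMap_apply] at this
      rw [this]; simp

theorem ip_self_nonneg (x : AlgFock B) : 0 ≤ (D.ip x x).re := by
  classical
  rw [← DirectSum.sum_support_of x]
  set s := DFinsupp.support x
  have : D.ip (∑ i ∈ s, DirectSum.of (fun n => ⨂[ℂ]^n B) i (x i))
      (∑ i ∈ s, DirectSum.of (fun n => ⨂[ℂ]^n B) i (x i))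
      = ∑ i ∈ s, D.ip (DirectSum.of (fun n => ⨂[ℂ]^n B) i (x i))
        (DirectSum.of (fun n => ⨂[ℂ]^n B) i (x i)) := by
    have h1 : ∀ (y : AlgFock B) (f : ℕ → AlgFock B),
        D.ip (∑ i ∈ s, f i) y = ∑ i ∈ s, D.ip (f i) y := by
      intro y f; simp [ip, map_sum]
    have h2 : ∀ (y : AlgFock B) (f : ℕ → AlgFock B),
        D.ip y (∑ i ∈ s, f i) = ∑ i ∈ s, D.ip y (f i) := by
      intro y f; simp [ip, map_sum]
    rw [h1]
    refine Finset.sum_congr rfl fun i hi => ?_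
    rw [h2]
    exact Finset.sum_eq_single_of_mem i hi fun j _ hj => D.ip_of_of_ne (Ne.symm hj) _ _
  rw [this, Complex.re_sum]
  exact Finset.sum_nonneg fun i _ => D.ip_lof_nonneg i _

/-! ### The Fock space -/

/-- The algebraic Fock space as a carrier of the semi-inner product `ip`. -/
def Pre (_ : FockData B) : Type _ := AlgFock B

instance : AddCommGroup D.Pre := inferInstanceAs (AddCommGroup (AlgFock B))
instance : Module ℂ D.Pre := inferInstanceAs (Module ℂ (AlgFock B))

/-- The semi-inner product as a Mathlib structure. Mathlib's inner products are conjugate-linear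
in the first argument, so `inner ℂ x y` is `ip y x`. -/
@[reducible] def core : PreInnerProductSpace.Core ℂ D.Pre where
  inner x y := D.ip y x
  conj_inner_symm x y := D.conj_ip x y
  re_inner_nonneg x := D.ip_self_nonneg x
  add_left x y z := D.ip_add_right z x y
  smul_left x y c := D.ip_smul_right c y x

instance : SeminormedAddCommGroup D.Pre :=
  @InnerProductSpace.Core.toSeminormedAddCommGroup ℂ D.Pre _ _ _ D.core

instance : InnerProductSpace ℂ D.Pre := InnerProductSpace.ofCore D.core

/-- The Fock space: the completion of the quotient of the algebraic Fock space by the vectors of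
zero seminorm. (Mathlib's completion of a seminormed space is automatically separated.) -/
abbrev Fock : Type _ := UniformSpace.Completion D.Pre

/-- The canonical map of the algebraic Fock space into the Fock space. -/
def toFock : AlgFock B →ₗ[ℂ] D.Fock :=
  (UniformSpace.Completion.toComplₗᵢ : D.Pre →ₗᵢ[ℂ] D.Fock).toLinearMap

theorem inner_toFock (x y : AlgFock B) : inner ℂ (D.toFock x) (D.toFock y) = D.ip y x :=
  UniformSpace.Completion.inner_coe (𝕜 := ℂ) (E := D.Pre) x y

theorem denseRange_toFock : DenseRange D.toFock :=
  UniformSpace.Completion.denseRange_coe (α := D.Pre)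

/-- The inner product of two simple tensors of positive degree. -/
theorem inner_simple (n : ℕ) (u v : Fin (n + 1) → B) :
    inner ℂ (D.toFock (simple B (n + 1) v)) (D.toFock (simple B (n + 1) u))
      = D.phi (star (v (Fin.last n))
        * D.nest n (fun i => star (v i.castSucc)) (fun i => u i.castSucc) * u (Fin.last n)) := by
  rw [inner_toFock, ip_simple]; rfl

/-- The vacuum vector in the Fock space. -/
def Omega : D.Fock := D.toFock vac

/-- An operator on the algebraic Fock space is bounded if it is bounded for the seminorm. -/
def IsBounded (T : AlgFock B →ₗ[ℂ] AlgFock B) : Prop :=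
  ∃ C : ℝ, ∀ x, ‖D.toFock (T x)‖ ≤ C * ‖D.toFock x‖

/-- An operator on the algebraic Fock space, on the carrier `Pre`. -/
def onPre (T : AlgFock B →ₗ[ℂ] AlgFock B) : D.Pre →ₗ[ℂ] D.Pre := T

theorem onPre_bound (T : AlgFock B →ₗ[ℂ] AlgFock B) (hT : D.IsBounded T) :
    ∃ C : ℝ, ∀ x, ‖D.onPre T x‖ ≤ C * ‖x‖ := by
  obtain ⟨C, hC⟩ := hT
  refine ⟨C, fun x => ?_⟩
  have h : ∀ y : D.Pre, ‖D.toFock y‖ = ‖y‖ := fun y => UniformSpace.Completion.norm_coe y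
  calc ‖D.onPre T x‖ = ‖D.toFock (T x)‖ := (h (D.onPre T x)).symm
    _ ≤ C * ‖D.toFock x‖ := hC x
    _ = C * ‖x‖ := congrArg (C * ·) (h x)

/-- The extension of a bounded operator to the Fock space. -/
def ext (T : AlgFock B →ₗ[ℂ] AlgFock B) (hT : D.IsBounded T) : D.Fock →L[ℂ] D.Fock :=
  (LinearMap.mkContinuousOfExistsBound (D.onPre T) (D.onPre_bound T hT)).completion

theorem ext_toFock (T : AlgFock B →ₗ[ℂ] AlgFock B) (hT : D.IsBounded T) (x : AlgFock B) :
    D.ext T hT (D.toFock x) = D.toFock (T x) :=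
  ContinuousLinearMap.completion_apply_coe _ _

end FockData

/-! ### Von Neumann algebras -/

section VonNeumann

variable {H : Type*} [NormedAddCommGroup H] [InnerProductSpace ℂ H] [CompleteSpace H]

/-- The von Neumann algebra `W*(s)` generated by a set of bounded operators, the double commutant
of `s ∪ s*`. -/
def vonNeumannGen (s : Set (H →L[ℂ] H)) : VonNeumannAlgebra H where
  toStarSubalgebra := StarSubalgebra.centralizer ℂ (StarSubalgebra.centralizer ℂ s : Set (H →L[ℂ] H))
  centralizer_centralizer' := by
    have h : (StarSubalgebra.centralizer ℂ (StarSubalgebra.centralizer ℂ s : Set (H →L[ℂ] H)) :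
        StarSubalgebra ℂ (H →L[ℂ] H)).carrier = (s ∪ star s).centralizer.centralizer :=
      StarSubalgebra.coe_centralizer_centralizer ℂ s
    rw [h, Set.centralizer_centralizer_centralizer]

theorem subset_vonNeumannGen (s : Set (H →L[ℂ] H)) {A : H →L[ℂ] H} (hA : A ∈ s) :
    A ∈ (vonNeumannGen s).toStarSubalgebra := by
  have h : ((vonNeumannGen s).toStarSubalgebra : Set (H →L[ℂ] H))
      = (s ∪ star s).centralizer.centralizer :=
    StarSubalgebra.coe_centralizer_centralizer ℂ s
  rw [← SetLike.mem_coe, h]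
  exact Set.subset_centralizer_centralizer (Or.inl hA)

/-- `J` is the modular conjugation of the von Neumann algebra `M` with respect to the cyclic and
separating vector `Ω`: the closure of the operator `A Ω ↦ A* Ω`, `A ∈ M`, has the polar
decomposition `J P` with `J` antiunitary and `P` (the square root of the modular operator) positive
self-adjoint. -/
structure IsModularConjugation (M : VonNeumannAlgebra H) (Ω : H) (J : H ≃ₗᵢ⋆[ℂ] H) : Prop where
  cyclic : Dense {x : H | ∃ A ∈ M, x = A Ω}
  separating : ∀ A ∈ M, A Ω = 0 → A = 0
  polar : ∃ P : H →ₗ.[ℂ] H, IsSelfAdjoint P ∧ (∀ x : P.domain, 0 ≤ (inner ℂ (x : H) (P x)).re) ∧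
    closure {p : H × H | ∃ A ∈ M, p = (A Ω, star A Ω)}
      = {p : H × H | ∃ x : P.domain, p = ((x : H), J (P x))}

end VonNeumann

/-! ### Wick polynomials -/

namespace FockData

open AlgFock

variable {B : Type*} [Ring B] [StarRing B] [Algebra ℂ B] [StarModule ℂ B] (D : FockData B)

/-- The Wick polynomial `W(u 1, ..., u n)` in operators `X(u)`, `u ∈ B`. -/
def wick {A : Type*} [Ring A] [Algebra ℂ A] (X : B → A) : List B → A
  | [] => 1
  | [u] => X u
  | [u, v] => X u * X v - X (D.Lambda u v) - algebraMap ℂ A (D.phi (u * v))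
  | u :: v :: w :: l =>
      X u * wick X (v :: w :: l) - wick X (D.Lambda u v :: w :: l)
        - wick X (D.psi (u * v) * w :: l)
  termination_by l => l.length

/-! ### The algebra generated by the operators `X(u)` and traciality -/

variable (hX : ∀ u, D.IsBounded (D.X u))

/-- The bounded operator `X(u)` on the Fock space. -/
def XOp (u : B) : D.Fock →L[ℂ] D.Fock := D.ext (D.X u) (hX u)

/-- The von Neumann algebra `W*(X(u) : u ∈ B)`. -/
def Gamma : VonNeumannAlgebra D.Fock := vonNeumannGen (Set.range (D.XOp hX))

theorem XOp_mem_Gamma (u : B) : D.XOp hX u ∈ (D.Gamma hX).toStarSubalgebra :=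
  subset_vonNeumannGen _ ⟨u, rfl⟩

/-- The vacuum state `A ↦ ⟨A Ω, Ω⟩` is tracial on `M`. -/
def VacuumTracial (M : VonNeumannAlgebra D.Fock) : Prop :=
  ∀ A ∈ M, ∀ A' ∈ M, inner ℂ D.Omega ((A * A') D.Omega) = inner ℂ D.Omega ((A' * A) D.Omega)

/-- `phi` is tracial. -/
def PhiTracial : Prop := ∀ u v, D.phi (u * v) = D.phi (v * u)

/-- `Λ(v* ⊗ u*)* = Λ(u ⊗ v)`. -/
def TraceStar : Prop := ∀ u v, star (D.Lambda (star v) (star u)) = D.Lambda u v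

/-- `u γ[y v] - γ[u y] v = Λ(u ⊗ Λ(y ⊗ v)) - Λ(Λ(u ⊗ y) ⊗ v)`. -/
def TraceAssoc : Prop := ∀ u y v,
  u * D.gamma (y * v) - D.gamma (u * y) * v
    = D.Lambda u (D.Lambda y v) - D.Lambda (D.Lambda u y) v

/-- `Λ(u ⊗ y γ[z v]) - Λ(u ⊗ y) γ[z v] = Λ(γ[u y] z ⊗ v) - γ[u y] Λ(z ⊗ v)`. -/
def TraceExtra : Prop := ∀ u y z v,
  D.Lambda u (y * D.gamma (z * v)) - D.Lambda u y * D.gamma (z * v)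
    = D.Lambda (D.gamma (u * y) * z) v - D.gamma (u * y) * D.Lambda z v

/-- `φ[γ[u] v] = φ[u γ[v]]`. -/
def GammaSymmetric : Prop := ∀ u v, D.phi (D.gamma u * v) = D.phi (u * D.gamma v)

/-- Each right operator `X_r(u)`, with the algebraic Fock space as its domain, commutes with the
generators `X(v)` of the von Neumann algebra. The vectors are compared in the Fock space. -/
def RightCommutes : Prop := ∀ (u v : B) (x : AlgFock B),
  D.toFock (D.Xr u (D.X v x)) = D.toFock (D.X v (D.Xr u x))

/-- The closure in `Fock × Fock` of the graph of an operator with domain the algebraic Fock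
space. -/
def closedGraph (T : AlgFock B →ₗ[ℂ] AlgFock B) : Submodule ℂ (D.Fock × D.Fock) :=
  (LinearMap.range (D.toFock.prod (D.toFock ∘ₗ T))).topologicalClosure

/-- The operator `T`, with domain the algebraic Fock space, is a well-defined closable operator in
the Fock space. -/
def IsClosable (T : AlgFock B →ₗ[ℂ] AlgFock B) : Prop :=
  ∀ y : D.Fock, ((0 : D.Fock), y) ∈ D.closedGraph T → y = 0

/-- The closure `T'` of `T` commutes with the von Neumann algebra `M`, in the usual sense
`A T' ⊆ T' A` for all `A ∈ M`. -/
def ClosureCommutes (M : VonNeumannAlgebra D.Fock) (T : AlgFock B →ₗ[ℂ] AlgFock B) : Prop :=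
  ∀ A ∈ M, ∀ p ∈ D.closedGraph T, (A p.1, A p.2) ∈ D.closedGraph T

end FockData

end

/-!
The proof works with words `word [u₁, ..., uₙ] = u₁ ⊗ ... ⊗ uₙ`. On them `X(b)` changes at most the
first two letters, and `X_r(b)` at most the last two (`X_word`, `Xr_word`).

For the commutation of `X_r(u)` with `X(v)` only words of length at most two matter, since on longer
words the two operators touch disjoint letters or commute by associativity. The components of the
commutator on words of length `0`, `1` and `2` give the four conditions (`rightCommutes_iff`);
faithfulness of `phi` turns equality modulo null vectors into equality in `B`. The closure of the
graph of `X_r(u)` is a closed subspace invariant under `X(v) × X(v)` for all `v`. As the family of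
the `X(v)` is closed under adjoints (`ip_X`), the blocks of the orthogonal projection onto it commute
with all `X(v)`, hence with all of `W*(X(v))` (`prod_mem_of_mem_vonNeumannGen`).

If the vacuum state is tracial, then the moments `⟨X(u₁) ⋯ X(uₙ) Ω, Ω⟩` are invariant under cyclic
permutations. For `n = 2, 3, 4` this says in turn that `phi` is tracial, that `φ[a Λ(b ⊗ c)]` is
cyclic, which gives `TraceStar`, and that `TraceAssoc` holds; for `n = 5` it says
`Λ(u ⊗ γ[w] v) = Λ(u γ[w] ⊗ v)` for products `w`, which is equivalent to `TraceExtra` modulo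
`TraceAssoc`.

If `phi` is tracial and the right operators commute with the left ones, then `S` preserves the
semi-inner product up to conjugation (`ip_S`), because a word contraction can be read from either
end. It extends to an antiunitary involution `J` with `J X(u) Ω = X(u)* Ω` and
`J X(u)* J = X_r(u)`, an operator that commutes with all `X(v)`. Everything else follows from the
relation `J A Ω = A* Ω` for all `A` in the von Neumann algebra. It holds on the algebra generated by
the `X(u)`, whose orbit of `Ω` contains all words by the Wick polynomials (`wick_apply_Omega`), and
extends to the double commutant by pairing with that orbit (`IsConjugation.map_apply_vec`), so that
no density theorem is needed. It yields traciality, `J M J ⊆ M'`, the same relation for `M'`, hence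
`J M' J ⊆ M`, and that the vacuum is separating; the modular operator is the identity.
-/

noncomputable section

set_option linter.unusedSectionVars false

/-! ### Words in the algebraic Fock space -/

namespace AlgFock

section Words

variable {B : Type*} [Ring B] [Algebra ℂ B]

/-- The simple tensor of the letters of a list. -/
def word (l : List B) : AlgFock B := simple B l.length l.get

theorem simple_eq_word {n : ℕ} (u : Fin n → B) : simple B n u = word (List.ofFn u) := by
  have key : ∀ (m : ℕ) (h : m = n) (v : Fin m → B), (∀ i, v i = u (Fin.cast h i)) →
      simple B n u = simple B m v := by
    rintro m rfl v hv
    exact congrArg _ (funext fun i => (hv i).symm)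
  exact key _ List.length_ofFn _ fun i => by simp; rfl

theorem word_nil : word ([] : List B) = vac := simple_eq_word (B := B) Fin.elim0 |>.symm

theorem simple_cons_get (b : B) (l : List B) :
    simple B (l.length + 1) (Fin.cons b l.get) = word (b :: l) :=
  congrArg _ (funext fun i => by refine Fin.cases ?_ (fun j => ?_) i <;> rfl)

theorem word_cons (b : B) (l : List B) :
    word (b :: l) = (simple B (l.length + 1)).curryLeft b l.get :=
  (simple_cons_get b l).symm

theorem word_cons_add (a b : B) (l : List B) :
    word ((a + b) :: l) = word (a :: l) + word (b :: l) := by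
  simp only [word_cons, map_add, _root_.add_apply]

theorem word_cons_sub (a b : B) (l : List B) :
    word ((a - b) :: l) = word (a :: l) - word (b :: l) := by
  simp only [word_cons, map_sub, _root_.sub_apply]

theorem word_cons_smul (c : ℂ) (a : B) (l : List B) :
    word ((c • a) :: l) = c • word (a :: l) := by
  simp only [word_cons, map_smul, _root_.smul_apply]

theorem word_induction {p : AlgFock B → Prop} (x : AlgFock B)
    (hs : ∀ (c : ℂ) (l : List B), p (c • word l))
    (h0 : p 0) (ha : ∀ x y, p x → p y → p (x + y)) : p x :=
  AlgFock.induction x (fun c n u => by rw [simple_eq_word]; exact hs c _) h0 ha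

/-- Linear maps (over any ring homomorphism) on the algebraic Fock space agree if they agree on
words. -/
theorem ext_word {σ : ℂ →+* ℂ} {E : Type*} [AddCommGroup E] [Module ℂ E]
    {f g : AlgFock B →ₛₗ[σ] E} (h : ∀ l, f (word l) = g (word l)) : f = g := by
  refine LinearMap.ext fun x => ?_
  induction x using word_induction with
  | hs c l => rw [map_smulₛₗ, map_smulₛₗ, h]
  | h0 => rw [map_zero, map_zero]
  | ha x y hx hy => rw [map_add, map_add, hx, hy]

variable [StarRing B] [StarModule ℂ B]

theorem map_star_star {α : Type*} [InvolutiveStar α] (l : List α) : l.map (star ∘ star) = l := by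
  rw [star_involutive.comp_self, List.map_id]

theorem S_word (l : List B) : S B (word l) = word ((l.map star).reverse) := by
  rw [word, S_simple, simple_eq_word]
  congr 1
  refine List.ext_getElem (by simp) fun i h1 h2 => ?_
  simp only [List.getElem_ofFn, List.get_eq_getElem, Fin.val_rev, List.getElem_reverse,
    List.getElem_map, List.length_map]
  congr 2
  omega

theorem S_S (x : AlgFock B) : S B (S B x) = x := by
  have : (S B).comp (S B) = LinearMap.id (R := ℂ) (M := AlgFock B) :=
    ext_word fun l => by simp [S_word, List.map_reverse, map_star_star]
  exact LinearMap.congr_fun this x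

end Words

end AlgFock

namespace FockData

open AlgFock

variable {B : Type*} [Ring B] [StarRing B] [Algebra ℂ B] [StarModule ℂ B] (D : FockData B)

/-! ### The left operators on words -/

theorem creation_word (b : B) (l : List B) : creation b (word l) = word (b :: l) := by
  rw [word, creation_simple, simple_cons_get]

theorem preservation_word (b y : B) (l : List B) :
    D.preservation b (word (y :: l)) = word (D.Lambda b y :: l) := by
  rw [← simple_cons_get, preservation_simple, simple_cons_get]

theorem annihilation_word_single (b y : B) :
    D.annihilation b (word [y]) = D.phi (b * y) • word [] := by
  rw [word_nil, ← annihilation_simple_one, simple_eq_word]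
  rfl

theorem annihilation_word (b y z : B) (l : List B) :
    D.annihilation b (word (y :: z :: l)) = word (D.psi (b * y) * z :: l) := by
  have h : (z :: l).get = Fin.cons z l.get :=
    funext fun i => by refine Fin.cases ?_ (fun j => ?_) i <;> rfl
  rw [← simple_cons_get, ← simple_cons_get, h]
  exact D.annihilation_simple b l.length y z l.get

theorem X_word_nil (b : B) : D.X b (word []) = word [b] := by
  rw [X, LinearMap.add_apply, LinearMap.add_apply, creation_word, word_nil, annihilation_vac,
    preservation_vac, add_zero, add_zero]

theorem X_word_single (b y : B) :
    D.X b (word [y]) = word [b, y] + D.phi (b * y) • word [] + word [D.Lambda b y] := by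
  rw [X, LinearMap.add_apply, LinearMap.add_apply, creation_word, annihilation_word_single,
    preservation_word]

theorem X_word (b y z : B) (l : List B) :
    D.X b (word (y :: z :: l)) = word (b :: y :: z :: l) + word (D.psi (b * y) * z :: l)
      + word (D.Lambda b y :: z :: l) := by
  rw [X, LinearMap.add_apply, LinearMap.add_apply, creation_word, annihilation_word,
    preservation_word]

theorem X_add (a b : B) : D.X (a + b) = D.X a + D.X b := by
  refine ext_word fun l => ?_
  rw [LinearMap.add_apply]
  match l with
  | [] => simp only [X_word_nil, word_cons_add]
  | [y] =>
    simp only [X_word_single, word_cons_add, add_mul, map_add, LinearMap.add_apply, add_smul]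
    abel
  | y :: z :: l =>
    simp only [X_word, word_cons_add, add_mul, map_add, LinearMap.add_apply]
    abel

theorem X_smul (c : ℂ) (b : B) : D.X (c • b) = c • D.X b := by
  refine ext_word fun l => ?_
  rw [LinearMap.smul_apply]
  match l with
  | [] => simp only [X_word_nil, word_cons_smul]
  | [y] =>
    simp only [X_word_single, word_cons_smul, smul_mul_assoc, map_smul, LinearMap.smul_apply,
      smul_add, smul_assoc]
  | y :: z :: l =>
    simp only [X_word, word_cons_smul, smul_mul_assoc, map_smul, LinearMap.smul_apply, smul_add]

/-! ### The right operators on words -/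

theorem Xr_word_nil (b : B) : D.Xr b (word []) = word [b] := by
  simp [Xr, S_word, X_word_nil]

theorem Xr_word_single (b y : B) :
    D.Xr b (word [y]) = word [y, b] + D.phi (y * b) • word []
      + word [star (D.Lambda (star b) (star y))] := by
  have h : conj (D.phi (star b * star y)) = D.phi (y * b) := by
    rw [← phi_star, star_mul, star_star, star_star]
  simp [Xr, S_word, X_word_single, h]

theorem Xr_word (b y z : B) (l : List B) :
    D.Xr b (word (l ++ [y, z])) = word (l ++ [y, z, b]) + word (l ++ [y * D.psi (z * b)])
      + word (l ++ [y, star (D.Lambda (star b) (star z))]) := by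
  simp [Xr, S_word, X_word, ← psi_star, map_star_star]

/-! ### The inner product on words, and adjoints -/

theorem ip_word_of_length_ne {l l' : List B} (h : l.length ≠ l'.length) :
    D.ip (word l) (word l') = 0 := D.ip_simple_of_ne h _ _

theorem ip_word_nil : D.ip (word []) (word []) = 1 := by
  rw [word, ip_simple]; rfl

theorem ip_word_single (a b : B) : D.ip (word [a]) (word [b]) = D.phi (star b * a) := by
  refine (D.ip_simple 1 [a].get [b].get).trans ?_
  simp [wordForm, nest]

theorem nest_succ {n : ℕ} (w u : Fin (n + 1) → B) :
    D.nest (n + 1) w u = D.psi (w (Fin.last n)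
      * D.nest n (fun i => w i.castSucc) (fun i => u i.castSucc) * u (Fin.last n)) := rfl

/-- The value of `nest` depends on the first letters only through their contraction. -/
theorem nest_congr_first {n : ℕ} {w w' u u' : Fin (n + 1) → B}
    (hψ : D.psi (w 0 * u 0) = D.psi (w' 0 * u' 0))
    (hw : ∀ i : Fin n, w i.succ = w' i.succ) (hu : ∀ i : Fin n, u i.succ = u' i.succ) :
    D.nest (n + 1) w u = D.nest (n + 1) w' u' := by
  induction n with
  | zero => simpa [nest] using hψ
  | succ n ih =>
    rw [D.nest_succ w, D.nest_succ w', ih (w := fun i => w i.castSucc) (w' := fun i => w' i.castSucc)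
      (u := fun i => u i.castSucc) (u' := fun i => u' i.castSucc) hψ (fun i => hw i.castSucc)
      (fun i => hu i.castSucc), ← Fin.succ_last, hw, hu]

theorem wordForm_congr_first {n : ℕ} {w w' u u' : Fin (n + 1) → B}
    (hφ : D.phi (w 0 * u 0) = D.phi (w' 0 * u' 0))
    (hψ : D.psi (w 0 * u 0) = D.psi (w' 0 * u' 0))
    (hw : ∀ i : Fin n, w i.succ = w' i.succ) (hu : ∀ i : Fin n, u i.succ = u' i.succ) :
    D.wordForm (n + 1) w u = D.wordForm (n + 1) w' u' := by
  cases n with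
  | zero => simpa [wordForm, nest] using hφ
  | succ n =>
    rw [wordForm, wordForm, D.nest_congr_first (w := fun i => w i.castSucc)
      (w' := fun i => w' i.castSucc) (u := fun i => u i.castSucc) (u' := fun i => u' i.castSucc)
      hψ (fun i => hw i.castSucc) (fun i => hu i.castSucc), ← Fin.succ_last, hw, hu]

/-- The innermost contraction of `nest` can be absorbed into the next letter. -/
theorem nest_absorb {n : ℕ} {w u : Fin (n + 2) → B} {w' u' : Fin (n + 1) → B}
    (hw : ∀ i, w' i = w i.succ) (h0 : u' 0 = D.psi (w 0 * u 0) * u 1)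
    (hu : ∀ i : Fin n, u' i.succ = u i.succ.succ) :
    D.nest (n + 2) w u = D.nest (n + 1) w' u' := by
  induction n with
  | zero =>
    have h1 : w' 0 = w 1 := hw 0
    have e1 : Fin.last 1 = (1 : Fin 2) := rfl
    have e2 : Fin.last 0 = (0 : Fin 1) := rfl
    simp [nest, e1, e2, h1, h0, mul_assoc]
  | succ n ih =>
    rw [D.nest_succ w, D.nest_succ w', ih (w := fun i => w i.castSucc) (u := fun i => u i.castSucc)
      (w' := fun i => w' i.castSucc) (u' := fun i => u' i.castSucc) (fun i => hw i.castSucc) h0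
      (fun i => hu i.castSucc), hw, ← Fin.succ_last (n + 1), ← Fin.succ_last n, hu]

theorem wordForm_absorb {n : ℕ} {w u : Fin (n + 2) → B} {w' u' : Fin (n + 1) → B}
    (hw : ∀ i, w' i = w i.succ) (h0 : u' 0 = D.psi (w 0 * u 0) * u 1)
    (hu : ∀ i : Fin n, u' i.succ = u i.succ.succ) :
    D.wordForm (n + 2) w u = D.wordForm (n + 1) w' u' := by
  cases n with
  | zero =>
    have h1 : w' 0 = w 1 := hw 0
    have e1 : Fin.last 1 = (1 : Fin 2) := rfl
    have e2 : Fin.last 0 = (0 : Fin 1) := rfl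
    simp [wordForm, nest, e1, e2, h1, h0, mul_assoc]
  | succ n =>
    rw [wordForm, wordForm, D.nest_absorb (w := fun i => w i.castSucc) (u := fun i => u i.castSucc)
      (w' := fun i => w' i.castSucc) (u' := fun i => u' i.castSucc) (fun i => hw i.castSucc) h0
      (fun i => hu i.castSucc), hw, ← Fin.succ_last (n + 1), ← Fin.succ_last n, hu]

/-- Formal adjointness can be checked on words. -/
theorem ip_eq_of_word {f g : AlgFock B →ₗ[ℂ] AlgFock B}
    (h : ∀ l l', D.ip (f (word l)) (word l') = D.ip (word l) (g (word l')))
    (x y : AlgFock B) : D.ip (f x) y = D.ip x (g y) := by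
  induction x using word_induction with
  | h0 => rw [map_zero, ip_zero_left, ip_zero_left]
  | ha x x' hx hx' => rw [map_add, ip_add_left, ip_add_left, hx, hx']
  | hs c l =>
    rw [map_smul, ip_smul_left, ip_smul_left]
    congr 1
    induction y using word_induction with
    | h0 => rw [map_zero, ip_zero_right, ip_zero_right]
    | ha y y' hy hy' => rw [map_add, ip_add_right, ip_add_right, hy, hy']
    | hs d l' => rw [map_smul, ip_smul_right, ip_smul_right, h]

theorem ip_creation (b : B) (x y : AlgFock B) :
    D.ip (creation b x) y = D.ip x (D.annihilation (star b) y) := by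
  refine D.ip_eq_of_word (fun l l' => ?_) x y
  rw [creation_word]
  match l' with
  | [] => rw [word_nil, annihilation_vac, ip_zero_right, ← word_nil,
      D.ip_word_of_length_ne (by simp)]
  | [v] =>
    rw [annihilation_word_single, ip_smul_right]
    cases l with
    | nil =>
      rw [ip_word_single, ip_word_nil, mul_one, ← phi_star, star_mul, star_star]
    | cons a l => rw [D.ip_word_of_length_ne (by simp), D.ip_word_of_length_ne (by simp), mul_zero]
  | v :: v' :: l' =>
    rw [annihilation_word]
    by_cases h : l.length = l'.length + 1
    · obtain ⟨a, l, rfl⟩ := List.exists_cons_of_length_eq_add_one h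
      have h' : l.length = l'.length := by simpa using h
      obtain ⟨n, u, rfl⟩ : ∃ n, ∃ u : Fin n → B, l = List.ofFn u := ⟨_, l.get, by simp⟩
      obtain ⟨m, w, rfl⟩ : ∃ n, ∃ u : Fin n → B, l' = List.ofFn u := ⟨_, l'.get, by simp⟩
      obtain rfl : n = m := by simpa using h'
      have e1 : ∀ c d : B, word (c :: d :: List.ofFn u)
          = simple B (n + 2) (Fin.cons c (Fin.cons d u : Fin (n + 1) → B)) := fun c d => by
        simp [simple_eq_word]
      have e2 : ∀ c : B, word (c :: List.ofFn u)
          = simple B (n + 1) (Fin.cons c u : Fin (n + 1) → B) := fun c => by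
        simp [simple_eq_word]
      have e3 : ∀ c d : B, word (c :: d :: List.ofFn w)
          = simple B (n + 2) (Fin.cons c (Fin.cons d w : Fin (n + 1) → B)) := fun c d => by
        simp [simple_eq_word]
      have e4 : ∀ c : B, word (c :: List.ofFn w)
          = simple B (n + 1) (Fin.cons c w : Fin (n + 1) → B) := fun c => by
        simp [simple_eq_word]
      rw [e1, e2, e3, e4, ip_simple, ip_simple, D.wordForm_absorb
        (w' := Fin.cons (star v') fun i => star (w i))
        (u' := Fin.cons (D.psi (star v * b) * a) u)]
      · have hs : star (D.psi (star b * v)) = D.psi (star v * b) := by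
          rw [← psi_star, star_mul, star_star]
        refine D.wordForm_congr_first ?_ ?_ (fun i => rfl) (fun i => rfl)
        · simp [hs, mul_assoc]
        · simp [hs, mul_assoc]
      · intro i
        refine Fin.cases ?_ (fun j => ?_) i <;> rfl
      · rfl
      · exact fun i => rfl
    · rw [D.ip_word_of_length_ne (by simpa using h), D.ip_word_of_length_ne (by simpa using h)]

theorem ip_annihilation (b : B) (x y : AlgFock B) :
    D.ip (D.annihilation b x) y = D.ip x (creation (star b) y) := by
  rw [← D.conj_ip y, ← D.conj_ip _ x, ip_creation, star_star]

theorem ip_preservation (b : B) (x y : AlgFock B) :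
    D.ip (D.preservation b x) y = D.ip x (D.preservation (star b) y) := by
  refine D.ip_eq_of_word (fun l l' => ?_) x y
  have h0 : ∀ b, D.preservation b (word []) = 0 := fun b => by rw [word_nil, preservation_vac]
  match l, l' with
  | [], [] => rw [h0, h0, ip_zero_right, ip_zero_left]
  | [], a :: l =>
    rw [h0, preservation_word, ip_zero_left, D.ip_word_of_length_ne (by simp)]
  | a :: l, [] =>
    rw [h0, preservation_word, ip_zero_right, D.ip_word_of_length_ne (by simp)]
  | a :: l, v :: l' =>
    rw [preservation_word, preservation_word]
    by_cases h : l.length = l'.length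
    · obtain ⟨n, u, rfl⟩ : ∃ n, ∃ u : Fin n → B, l = List.ofFn u := ⟨_, l.get, by simp⟩
      obtain ⟨m, w, rfl⟩ : ∃ n, ∃ u : Fin n → B, l' = List.ofFn u := ⟨_, l'.get, by simp⟩
      obtain rfl : n = m := by simpa using h
      have e2 : ∀ (c : B) (u : Fin n → B), word (c :: List.ofFn u)
          = simple B (n + 1) (Fin.cons c u : Fin (n + 1) → B) := fun c u => by
        simp [simple_eq_word]
      rw [e2, e2, e2, e2, ip_simple, ip_simple]
      refine D.wordForm_congr_first ?_ ?_ (fun i => rfl) (fun i => rfl)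
      · exact D.phi_Lambda b a v
      · rw [psi_apply, psi_apply]
        exact congrArg₂ (fun p q : B => p + q) (D.gamma_Lambda b a v)
          (congrArg _ (D.phi_Lambda b a v))
    · rw [D.ip_word_of_length_ne (by simpa using h), D.ip_word_of_length_ne (by simpa using h)]

/-- `X(b)` and `X(b*)` are formally adjoint. -/
theorem ip_X (b : B) (x y : AlgFock B) : D.ip (D.X b x) y = D.ip x (D.X (star b) y) := by
  simp only [X, LinearMap.add_apply, ip_add_left, ip_add_right, ip_creation, ip_annihilation,
    ip_preservation]
  ring

/-! ### The involution `S` is antiunitary in the tracial case -/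

/-- Reversing all letters and exchanging the two words preserves the form: absorb the first
contraction on one side, and move it through the trace and the symmetric map `psi` on the other. -/
theorem wordForm_rev (hφ : D.PhiTracial) (hγ : D.GammaSymmetric) (n : ℕ) (w u : Fin n → B) :
    D.wordForm n (fun i => u i.rev) (fun i => w i.rev) = D.wordForm n w u := by
  have hψ : ∀ a b, D.phi (D.psi a * b) = D.phi (a * D.psi b) := fun a b => by
    simp only [psi_apply, add_mul, mul_add, map_add, hγ a b, ← Algebra.smul_def, map_smul,
      ← Algebra.commutes, smul_eq_mul]
    ring
  match n with
  | 0 => rfl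
  | 1 =>
    simpa [wordForm, nest] using hφ _ _
  | n + 2 =>
    have ih := wordForm_rev hφ hγ (n + 1) (fun i => w i.succ)
      (Fin.cons (D.psi (w 0 * u 0) * u 1) fun i => u i.succ.succ)
    rw [D.wordForm_absorb (w := w) (u := u) (w' := fun i => w i.succ)
      (u' := Fin.cons (D.psi (w 0 * u 0) * u 1) fun i => u i.succ.succ) (fun i => rfl) rfl
      (fun i => rfl), ← ih]
    simp only [wordForm, nest, Fin.rev_last, Fin.rev_castSucc, Fin.cons_zero, Fin.cons_succ]
    rw [hφ (u 0 * _), ← mul_assoc, hφ (w 0 * u 0), hψ]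
    rw [hφ, Fin.succ_zero_eq_one]
    simp only [mul_assoc]

theorem ip_S (hφ : D.PhiTracial) (hγ : D.GammaSymmetric) (x y : AlgFock B) :
    D.ip (S B x) (S B y) = D.ip y x := by
  induction x using AlgFock.induction with
  | h0 => rw [map_zero, ip_zero_left, ip_zero_right]
  | ha x x' hx hx' => rw [map_add, ip_add_left, ip_add_right, hx, hx']
  | hs c n u =>
    rw [map_smulₛₗ, ip_smul_left, ip_smul_right]
    congr 1
    induction y using AlgFock.induction with
    | h0 => rw [map_zero, ip_zero_right, ip_zero_left]
    | ha y y' hy hy' => rw [map_add, ip_add_right, ip_add_left, hy, hy']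
    | hs d m v =>
      rw [map_smulₛₗ, ip_smul_right, ip_smul_left, Complex.conj_conj]
      congr 1
      rw [S_simple, S_simple]
      by_cases h : n = m
      · subst h
        rw [ip_simple, ip_simple, ← D.wordForm_rev hφ hγ]
        simp
      · rw [ip_simple_of_ne D h, ip_simple_of_ne D (Ne.symm h)]

end FockData

namespace FockData

open AlgFock

variable {B : Type*} [Ring B] [StarRing B] [Algebra ℂ B] [StarModule ℂ B] (D : FockData B)

/-! ### Commutation of the left and right operators -/

/-- Since `phi` is faithful, elements of `B` are determined by their pairings. -/
theorem eq_of_phi_mul {a b : B} (h : ∀ d, D.phi (d * a) = D.phi (d * b)) : a = b := by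
  rw [← sub_eq_zero]
  apply D.phi_faithful
  rw [mul_sub, map_sub, h, sub_self]

theorem ip_left_congr {x y : AlgFock B} (h : D.toFock x = D.toFock y) (z : AlgFock B) :
    D.ip x z = D.ip y z := by
  rw [← inner_toFock, ← inner_toFock, h]

theorem Xr_word_two (b y z : B) :
    D.Xr b (word [y, z]) = word [y, z, b] + word [y * D.psi (z * b)]
      + word [y, star (D.Lambda (star b) (star z))] := D.Xr_word b y z []

theorem Xr_word_three (b x y z : B) :
    D.Xr b (word [x, y, z]) = word [x, y, z, b] + word [x, y * D.psi (z * b)]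
      + word [x, y, star (D.Lambda (star b) (star z))] := D.Xr_word b y z [x]

/-- The commutator on the vacuum, in degree one. -/
theorem RightCommutes.traceStar {D : FockData B} (h : D.RightCommutes) : D.TraceStar := by
  refine fun v u => D.eq_of_phi_mul fun d => ?_
  have := D.ip_left_congr (h u v (word [])) (word [star d])
  simpa [Xr_word_nil, X_word_nil, Xr_word_single, X_word_single, ip_add_left, ip_smul_left,
    ip_word_single, ip_word_of_length_ne] using this

theorem psi_mul (a b : B) : D.psi a * b = D.gamma a * b + D.phi a • b := by
  rw [psi_apply, add_mul, Algebra.smul_def]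

theorem mul_psi (a b : B) : a * D.psi b = a * D.gamma b + D.phi b • a := by
  rw [psi_apply, mul_add, Algebra.smul_def, Algebra.commutes]

/-- The commutator on one-letter words, in degree one. -/
theorem RightCommutes.traceAssoc {D : FockData B} (h : D.RightCommutes) : D.TraceAssoc := by
  refine fun v y u => D.eq_of_phi_mul fun d => ?_
  have := D.ip_left_congr (h u v (word [y])) (word [star d])
  simp only [Xr_word_nil, X_word_nil, Xr_word_single, X_word_single, Xr_word_two, X_word, map_add,
    map_smul, ip_add_left, ip_smul_left, ip_word_single, ip_word_of_length_ne, List.length_cons,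
    List.length_nil, ne_eq, h.traceStar _ _, psi_mul, mul_psi, mul_add, star_star, mul_smul_comm,
    smul_eq_mul, not_false_eq_true, Nat.reduceAdd, OfNat.ofNat_ne_one,
    zero_add, add_zero, mul_zero, zero_ne_one] at this
  simp only [mul_sub, map_sub]
  linear_combination this

/-- The component of degree one of the commutator on words of length two is the defect in
`TraceExtra`; the scalar parts of `psi` cancel. -/
theorem ip_Xr_X_sub_X_Xr_two (h1 : D.TraceStar) (v u y z d : B) :
    D.ip (D.Xr u (D.X v (word [y, z]))) (word [d]) - D.ip (D.X v (D.Xr u (word [y, z]))) (word [d])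
      = D.phi (star d * (D.Lambda (D.gamma (v * y) * z) u - D.gamma (v * y) * D.Lambda z u
        - (D.Lambda v (y * D.gamma (z * u)) - D.Lambda v y * D.gamma (z * u)))) := by
  simp only [Xr_word_single, X_word_single, Xr_word_two, Xr_word_three, X_word, map_add,
    ip_add_left, ip_smul_left, ip_word_single, ip_word_of_length_ne, List.length_cons,
    List.length_nil, ne_eq, h1 _ _, psi_mul, mul_psi, mul_add, mul_smul_comm,
    smul_eq_mul, not_false_eq_true, Nat.reduceAdd, OfNat.ofNat_ne_one,
    zero_add, add_zero, mul_zero, zero_ne_one, map_smul, LinearMap.add_apply, LinearMap.smul_apply,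
    mul_sub, map_sub]
  ring

theorem RightCommutes.traceExtra {D : FockData B} (h : D.RightCommutes) : D.TraceExtra := by
  refine fun v y z u => D.eq_of_phi_mul fun d => ?_
  have := D.ip_Xr_X_sub_X_Xr_two h.traceStar v u y z (star d)
  rw [D.ip_left_congr (h u v (word [y, z])), sub_self, star_star, mul_sub, map_sub] at this
  exact (sub_eq_zero.mp this.symm).symm

/-- The commutator on two-letter words, in degree zero, for both operator arguments equal to
`1`. -/
theorem RightCommutes.gammaSymmetric {D : FockData B} (h : D.RightCommutes) :
    D.GammaSymmetric := by
  intro y z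
  have := D.ip_left_congr (h 1 1 (word [y, z])) (word [])
  simp only [Xr_word_single, X_word_single, Xr_word_two, Xr_word_three, X_word, map_add,
    ip_add_left, ip_smul_left, ip_word_nil, ip_word_of_length_ne, List.length_cons,
    List.length_nil, ne_eq, psi_mul, mul_psi, mul_add, mul_smul_comm, one_mul, mul_one,
    smul_eq_mul, not_false_eq_true, Nat.reduceAdd,
    zero_add, add_zero, one_ne_zero, OfNat.ofNat_ne_zero, map_smul] at this
  linear_combination this

theorem exists_eq_append_pair {α : Type*} (a b : α) (l : List α) :
    ∃ l' c d, a :: b :: l = l' ++ [c, d] := by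
  induction l generalizing a b with
  | nil => exact ⟨[], a, b, rfl⟩
  | cons e l ih =>
    obtain ⟨l', c, d, h⟩ := ih b e
    exact ⟨a :: l', c, d, by rw [h]; rfl⟩

/-- The left operators only change the first two letters of a word and the right operators only the
last two, so a defect of commutation can occur on words of length at most two; there the four
conditions remove it. On words of length three the two contractions share the middle letter, and
commute by associativity. -/
theorem Xr_X_of_conditions (h1 : D.TraceStar) (h2 : D.TraceAssoc) (h3 : D.TraceExtra)
    (h4 : D.GammaSymmetric) (u v : B) : (D.Xr u).comp (D.X v) = (D.X v).comp (D.Xr u) := by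
  refine ext_word fun l => ?_
  rw [LinearMap.comp_apply, LinearMap.comp_apply]
  match l with
  | [] =>
    simp only [Xr_word_nil, X_word_nil, Xr_word_single, X_word_single, h1 _ _]
  | [y] =>
    have e1 : D.phi (D.Lambda v y * u) = D.phi (v * D.Lambda y u) := by
      have := D.phi_Lambda y u (star v)
      rw [star_star] at this
      rw [this, h1]
    have e2 : D.Lambda (D.Lambda v y) u
        = D.Lambda v (D.Lambda y u) - (v * D.gamma (y * u) - D.gamma (v * y) * u) := by
      rw [h2]; abel
    simp only [Xr_word_nil, X_word_nil, Xr_word_single, X_word_single, Xr_word_two, X_word,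
      map_add, map_smul, h1 _ _, psi_mul, mul_psi, e1, e2, word_cons_add, word_cons_smul,
      word_cons_sub]
    abel
  | [y, z] =>
    have e1 : D.phi (D.psi (v * y) * z * u) = D.phi (v * (y * D.psi (z * u))) := by
      simp only [psi_mul, mul_psi, add_mul, mul_add, map_add, mul_assoc, h4 (v * y), smul_mul_assoc,
        mul_smul_comm, map_smul, smul_eq_mul]
      ring
    have e2 : D.Lambda (D.psi (v * y) * z) u + D.Lambda v y * D.psi (z * u)
        = D.psi (v * y) * D.Lambda z u + D.Lambda v (y * D.psi (z * u)) := by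
      simp only [psi_mul, mul_psi, map_add, map_smul, LinearMap.add_apply, LinearMap.smul_apply]
      have := (h3 v y z u).symm
      rw [← sub_eq_zero] at this ⊢
      rw [← this]
      abel
    have e3 : word [D.Lambda (D.psi (v * y) * z) u] = word [D.psi (v * y) * D.Lambda z u]
        + word [D.Lambda v (y * D.psi (z * u))] - word [D.Lambda v y * D.psi (z * u)] := by
      rw [← word_cons_add, ← word_cons_sub, ← e2, add_sub_cancel_right]
    simp only [Xr_word_single, X_word_single, Xr_word_two, Xr_word_three, X_word,
      map_add, h1 _ _, e1, e3]
    abel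
  | [y, z, w] =>
    have e := D.Xr_word u z w [v, y]
    simp only [List.cons_append, List.nil_append] at e
    simp only [Xr_word_two, Xr_word_three, X_word, map_add, e, mul_assoc]
    abel
  | y :: z :: w :: t :: l =>
    obtain ⟨l', a, b, h⟩ := exists_eq_append_pair w t l
    rw [h]
    have e : ∀ l, D.Xr u (word (l ++ (l' ++ [a, b]))) = word (l ++ (l' ++ [a, b, u]))
        + word (l ++ (l' ++ [a * D.psi (b * u)]))
        + word (l ++ (l' ++ [a, star (D.Lambda (star u) (star b))])) := fun l => by
      have := D.Xr_word u a b (l ++ l')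
      simpa only [List.append_assoc] using this
    have e1 := fun y => e [y]
    have e2 := fun y z => e [y, z]
    have e3 := fun v y z => e [v, y, z]
    simp only [List.cons_append, List.nil_append] at e1 e2 e3
    simp only [X_word, map_add, e1, e2, e3]
    abel

theorem rightCommutes_iff :
    D.RightCommutes ↔ D.TraceStar ∧ D.TraceAssoc ∧ D.TraceExtra ∧ D.GammaSymmetric :=
  ⟨fun h => ⟨h.traceStar, h.traceAssoc, h.traceExtra, h.gammaSymmetric⟩,
    fun ⟨h1, h2, h3, h4⟩ u v x => by
      exact congrArg D.toFock (LinearMap.congr_fun (D.Xr_X_of_conditions h1 h2 h3 h4 u v) x)⟩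

theorem traceExtra_of_scalar (h : ∀ u, ∃ c : ℂ, D.gamma u = algebraMap ℂ B c) : D.TraceExtra := by
  intro u y z v
  obtain ⟨c, hc⟩ := h (z * v)
  obtain ⟨d, hd⟩ := h (u * y)
  simp only [hc, hd, ← Algebra.smul_def, ← Algebra.commutes, map_smul, LinearMap.smul_apply,
    sub_self]

end FockData

/-! ### Generated von Neumann algebras and closed invariant subspaces -/

section VonNeumannGen

variable {H : Type*} [NormedAddCommGroup H] [InnerProductSpace ℂ H] [CompleteSpace H]

theorem mem_vonNeumannGen_iff {s : Set (H →L[ℂ] H)} {A : H →L[ℂ] H} :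
    A ∈ vonNeumannGen s ↔
      ∀ T : H →L[ℂ] H, (∀ g ∈ s, g * T = T * g ∧ star g * T = T * star g) → T * A = A * T := by
  change A ∈ StarSubalgebra.centralizer ℂ
    (StarSubalgebra.centralizer ℂ s : Set (H →L[ℂ] H)) ↔ _
  simp only [StarSubalgebra.mem_centralizer_iff]
  constructor
  · exact fun h T hT => (h T (StarSubalgebra.mem_centralizer_iff ℂ |>.2 hT)).1
  · intro h T hT
    exact ⟨h T (StarSubalgebra.mem_centralizer_iff ℂ |>.1 hT),
      h (star T) (StarSubalgebra.mem_centralizer_iff ℂ |>.1 (star_mem hT))⟩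

/-- A closed subspace of `H × H` that is invariant under `A × A` for the generators `A` and their
adjoints is invariant under `A × A` for all `A` in the generated von Neumann algebra: the blocks of
the orthogonal projection onto it commute with the generators, hence with `A`. -/
theorem prod_mem_of_mem_vonNeumannGen {s : Set (H →L[ℂ] H)} {K : Submodule ℂ (H × H)}
    (hK : IsClosed (K : Set (H × H)))
    (hs : ∀ A ∈ s, ∀ p ∈ K, (A p.1, A p.2) ∈ K ∧ (star A p.1, star A p.2) ∈ K)
    {A : H →L[ℂ] H} (hA : A ∈ vonNeumannGen s) {p : H × H} (hp : p ∈ K) :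
    (A p.1, A p.2) ∈ K := by
  let e := WithLp.prodContinuousLinearEquiv 2 ℂ H H
  let K' : Submodule ℂ (WithLp 2 (H × H)) := K.comap (e : WithLp 2 (H × H) →ₗ[ℂ] H × H)
  have hK' : IsClosed (K' : Set (WithLp 2 (H × H))) := hK.preimage e.continuous
  have : CompleteSpace K' := hK'.completeSpace_coe
  let P := K'.starProjection
  let δ : (H →L[ℂ] H) → WithLp 2 (H × H) → WithLp 2 (H × H) :=
    fun T v => WithLp.toLp 2 (T v.fst, T v.snd)
  have hP : ∀ T ∈ s, (∀ v, P (δ T v) = δ T (P v)) ∧ ∀ v, P (δ (star T) v) = δ (star T) (P v) := by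
    have key : ∀ T : H →L[ℂ] H,
        (∀ p ∈ K, (T p.1, T p.2) ∈ K ∧ (star T p.1, star T p.2) ∈ K) →
        ∀ v, P (δ T v) = δ T (P v) := by
      intro T hT v
      refine Submodule.eq_starProjection_of_mem_of_inner_eq_zero
        (hT (e (P v)) (K'.starProjection_apply_mem v)).1 fun w hw => ?_
      have h1 : δ (star T) w ∈ K' := (hT (e w) hw).2
      have h2 := Submodule.inner_left_of_mem_orthogonal h1
        (Submodule.sub_starProjection_mem_orthogonal (K := K') v)
      rw [← h2]
      have h3 : ∀ x y : H, inner ℂ (T x) y = inner ℂ x (star T y) := fun x y =>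
        (ContinuousLinearMap.adjoint_inner_right T x y).symm
      simp [δ, P, WithLp.prod_inner_apply, inner_sub_left, h3]
    exact fun T hT => ⟨key T (hs T hT), key (star T) fun p hp => by
      rw [star_star]; exact (hs T hT p hp).symm⟩
  have hblock : ∀ (i : H →L[ℂ] WithLp 2 (H × H)) (q : WithLp 2 (H × H) →L[ℂ] H),
      (∀ (T : H →L[ℂ] H) x, i (T x) = δ T (i x)) → (∀ (T : H →L[ℂ] H) v, q (δ T v) = T (q v)) →
      ∀ x, q (P (i (A x))) = A (q (P (i x))) := by
    intro i q hi hq x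
    have := mem_vonNeumannGen_iff.1 hA (q ∘L P ∘L i) fun g hg => by
      constructor
      · ext x; simp [hi, (hP g hg).1, hq]
      · ext x; simp [hi, (hP g hg).2, hq]
    exact DFunLike.congr_fun this x
  let i₁ : H →L[ℂ] WithLp 2 (H × H) := e.symm ∘L ContinuousLinearMap.inl ℂ H H
  let i₂ : H →L[ℂ] WithLp 2 (H × H) := e.symm ∘L ContinuousLinearMap.inr ℂ H H
  have hi₁ : ∀ (T : H →L[ℂ] H) x, i₁ (T x) = δ T (i₁ x) := fun T x => by
    apply e.injective; simp [i₁, δ, e]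
  have hi₂ : ∀ (T : H →L[ℂ] H) x, i₂ (T x) = δ T (i₂ x) := fun T x => by
    apply e.injective; simp [i₂, δ, e]
  have hv : ∀ v : WithLp 2 (H × H), v = i₁ v.fst + i₂ v.snd := fun v => by
    apply e.injective; simp [i₁, i₂, e]; rfl
  have hq : ∀ q : WithLp 2 (H × H) →L[ℂ] H, (∀ (T : H →L[ℂ] H) v, q (δ T v) = T (q v)) →
      ∀ v, q (P (δ A v)) = A (q (P v)) := by
    intro q hq v
    have : δ A v = i₁ (A v.fst) + i₂ (A v.snd) := hv _
    rw [this, map_add, map_add, hblock i₁ q hi₁ hq, hblock i₂ q hi₂ hq, ← map_add, ← map_add,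
      ← map_add, ← hv]
  have h1 := hq (ContinuousLinearMap.fst ℂ H H ∘L e) (fun T v => rfl) (e.symm p)
  have h2 := hq (ContinuousLinearMap.snd ℂ H H ∘L e) (fun T v => rfl) (e.symm p)
  have hPp : P (e.symm p) = e.symm p := Submodule.starProjection_eq_self_iff.2 hp
  have hfix : P (δ A (e.symm p)) = δ A (e.symm p) := by
    rw [hPp] at h1 h2
    exact e.injective (Prod.ext h1 h2)
  exact Submodule.starProjection_eq_self_iff.1 hfix

end VonNeumannGen

namespace FockData

open AlgFock

variable {B : Type*} [Ring B] [StarRing B] [Algebra ℂ B] [StarModule ℂ B] (D : FockData B)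
variable (hX : ∀ u, D.IsBounded (D.X u))

/-! ### The generators of `Gamma` -/

/-- Continuous maps on the Fock space are determined by their values on the algebraic vectors. -/
theorem clm_ext {σ : ℂ →+* ℂ} {E : Type*} [NormedAddCommGroup E] [NormedSpace ℂ E]
    {f g : D.Fock →SL[σ] E} (h : ∀ x, f (D.toFock x) = g (D.toFock x)) : f = g :=
  DFunLike.coe_injective
    (D.denseRange_toFock.equalizer f.continuous g.continuous (funext h))

theorem XOp_toFock (u : B) (x : AlgFock B) : D.XOp hX u (D.toFock x) = D.toFock (D.X u x) :=
  D.ext_toFock _ _ _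

theorem star_XOp (u : B) : star (D.XOp hX u) = D.XOp hX (star u) := by
  symm
  rw [ContinuousLinearMap.star_eq_adjoint, ContinuousLinearMap.eq_adjoint_iff]
  intro x y
  refine D.denseRange_toFock.induction_on₂ (p := fun x y =>
    inner ℂ (D.XOp hX (star u) x) y = inner ℂ x (D.XOp hX u y)) ?_ (fun a b => ?_) x y
  · exact isClosed_eq (by fun_prop) (by fun_prop)
  · rw [XOp_toFock, XOp_toFock, inner_toFock, inner_toFock, ip_X]

theorem XOp_add (u v : B) : D.XOp hX (u + v) = D.XOp hX u + D.XOp hX v :=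
  D.clm_ext fun x => by simp [XOp_toFock, X_add]

theorem XOp_smul (c : ℂ) (u : B) : D.XOp hX (c • u) = c • D.XOp hX u :=
  D.clm_ext fun x => by simp [XOp_toFock, X_smul]

theorem mem_Gamma_iff {A : D.Fock →L[ℂ] D.Fock} :
    A ∈ D.Gamma hX ↔ ∀ T : D.Fock →L[ℂ] D.Fock,
      (∀ u, D.XOp hX u * T = T * D.XOp hX u) → T * A = A * T := by
  rw [Gamma, mem_vonNeumannGen_iff]
  simp only [Set.forall_mem_range, star_XOp]
  exact ⟨fun h T hT => h T fun u => ⟨hT u, hT _⟩, fun h T hT => h T fun u => (hT u).1⟩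

theorem mem_commutant_Gamma_iff {T : D.Fock →L[ℂ] D.Fock} :
    T ∈ (D.Gamma hX).commutant ↔ ∀ u, D.XOp hX u * T = T * D.XOp hX u := by
  rw [VonNeumannAlgebra.mem_commutant_iff]
  exact ⟨fun h u => h _ (D.XOp_mem_Gamma hX u), fun h A hA => ((D.mem_Gamma_iff hX).1 hA T h).symm⟩

theorem Gamma_eq_selfAdjoint :
    D.Gamma hX = vonNeumannGen (D.XOp hX '' {u | star u = u}) := by
  refine VonNeumannAlgebra.ext fun A => ?_
  rw [mem_Gamma_iff, mem_vonNeumannGen_iff]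
  refine forall_congr' fun T => imp_congr_left ?_
  simp only [Set.forall_mem_image, star_XOp, Set.mem_ofPred_eq]
  refine ⟨fun h u _ => ⟨h u, h _⟩, fun h u => ?_⟩
  have hu : u = (realPart u : B) + Complex.I • (imaginaryPart u : B) :=
    (realPart_add_I_smul_imaginaryPart u).symm
  rw [hu, XOp_add, XOp_smul, add_mul, mul_add, (h (realPart u).2).1, smul_mul_assoc,
    (h (imaginaryPart u).2).1, mul_smul_comm]

/-! ### Closures of the right operators -/

theorem mem_closedGraph (T : AlgFock B →ₗ[ℂ] AlgFock B) (x : AlgFock B) :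
    (D.toFock x, D.toFock (T x)) ∈ D.closedGraph T :=
  Submodule.le_topologicalClosure _ ⟨x, rfl⟩

theorem RightCommutes.closureCommutes {D : FockData B} (hX : ∀ u, D.IsBounded (D.X u))
    (h : D.RightCommutes) (u : B) : D.ClosureCommutes (D.Gamma hX) (D.Xr u) := by
  intro A hA p hp
  have key : ∀ v, ∀ p ∈ D.closedGraph (D.Xr u),
      (D.XOp hX v p.1, D.XOp hX v p.2) ∈ D.closedGraph (D.Xr u) := by
    intro v p hp
    refine closure_minimal (t := (fun p : D.Fock × D.Fock => (D.XOp hX v p.1, D.XOp hX v p.2)) ⁻¹'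
      (D.closedGraph (D.Xr u) : Set (D.Fock × D.Fock))) ?_ ?_ hp
    · rintro _ ⟨x, rfl⟩
      have := D.mem_closedGraph (D.Xr u) (D.X v x)
      rw [h] at this
      simpa [XOp_toFock] using this
    · exact (Submodule.isClosed_topologicalClosure _).preimage (by fun_prop)
  refine prod_mem_of_mem_vonNeumannGen (Submodule.isClosed_topologicalClosure _) ?_ hA hp
  rintro _ ⟨v, rfl⟩ p hp
  exact ⟨key v p hp, by rw [star_XOp]; exact key _ p hp⟩

theorem rightCommutes_of_closureCommutes (hc : ∀ u, D.IsClosable (D.Xr u))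
    (h : ∀ u, D.ClosureCommutes (D.Gamma hX) (D.Xr u)) : D.RightCommutes := by
  intro u v x
  have h1 := h u _ (D.XOp_mem_Gamma hX v) _ (D.mem_closedGraph (D.Xr u) x)
  have h2 := D.mem_closedGraph (D.Xr u) (D.X v x)
  simp only [XOp_toFock] at h1
  have h3 := Submodule.sub_mem _ h2 h1
  rw [Prod.mk_sub_mk, sub_self] at h3
  exact sub_eq_zero.1 (hc u _ h3)

end FockData

namespace FockData

open AlgFock

variable {B : Type*} [Ring B] [StarRing B] [Algebra ℂ B] [StarModule ℂ B] (D : FockData B)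
variable (hX : ∀ u, D.IsBounded (D.X u))

/-! ### Vacuum moments and the consequences of traciality -/

theorem prod_XOp_toFock (l : List B) (x : AlgFock B) :
    (l.map (D.XOp hX)).prod (D.toFock x) = D.toFock ((l.map D.X).prod x) := by
  induction l with
  | nil => rfl
  | cons u l ih =>
    simp only [List.map_cons, List.prod_cons, mul_apply_eq_comp, ih, XOp_toFock,
      Module.End.mul_apply]

theorem prod_XOp_mem_Gamma (l : List B) : (l.map (D.XOp hX)).prod ∈ D.Gamma hX :=
  list_prod_mem (S := D.Gamma hX) fun A hA => by
      obtain ⟨u, -, rfl⟩ := List.mem_map.1 hA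
      exact D.XOp_mem_Gamma hX u

/-- The moment `⟨X(u₁) ⋯ X(uₙ) Ω, Ω⟩`. -/
def moment (l : List B) : ℂ := D.ip ((l.map D.X).prod (word [])) (word [])

theorem moment_cons (u : B) (l : List B) :
    D.moment (u :: l) = D.ip ((l.map D.X).prod (word [])) (word [star u]) := by
  rw [moment, List.map_cons, List.prod_cons, Module.End.mul_apply, ip_X, X_word_nil]

theorem VacuumTracial.moment_rotate {D : FockData B} {hX : ∀ u, D.IsBounded (D.X u)}
    (h : D.VacuumTracial (D.Gamma hX)) (u : B) (l : List B) :
    D.moment (u :: l) = D.moment (l ++ [u]) := by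
  have key : ∀ l, D.moment l = inner ℂ D.Omega ((l.map (D.XOp hX)).prod D.Omega) := fun l => by
    rw [Omega, prod_XOp_toFock, inner_toFock, moment, word_nil]
  rw [key, key, List.map_cons, List.prod_cons, List.map_append, List.prod_append,
    h _ (D.XOp_mem_Gamma hX u) _ (D.prod_XOp_mem_Gamma hX l)]
  simp

theorem moment_two (t u : B) : D.moment [t, u] = D.phi (t * u) := by
  simp [moment_cons, X_word_nil, ip_word_single]

theorem moment_three (t u v : B) : D.moment [t, u, v] = D.phi (t * D.Lambda u v) := by
  simp [moment_cons, X_word_nil, X_word_single, ip_word_single, ip_add_left, ip_smul_left,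
    ip_word_of_length_ne]

theorem moment_four (t u y v : B) : D.moment [t, u, y, v]
    = D.phi (t * (D.gamma (u * y) * v)) + D.phi (u * y) * D.phi (t * v)
      + D.phi (t * D.Lambda u (D.Lambda y v)) + D.phi (y * v) * D.phi (t * u) := by
  simp [moment_cons, X_word_nil, X_word_single, X_word, ip_word_single, ip_add_left, ip_smul_left,
    ip_word_of_length_ne, psi_mul, mul_add]
  ring

theorem moment_five (t u y z v : B) : D.moment [t, u, y, z, v]
    = D.phi (t * (D.gamma (u * D.Lambda y z) * v)) + D.phi (u * D.Lambda y z) * D.phi (t * v)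
      + (D.phi (t * (D.gamma (u * y) * D.Lambda z v)) + D.phi (u * y) * D.phi (t * D.Lambda z v))
      + (D.phi (t * D.Lambda u (D.gamma (y * z) * v)) + D.phi (y * z) * D.phi (t * D.Lambda u v))
      + D.phi (t * D.Lambda u (D.Lambda y (D.Lambda z v))) + D.phi (z * v) * D.phi (t * D.Lambda u y)
      + D.phi (y * D.Lambda z v) * D.phi (t * u) := by
  simp [moment_cons, X_word_nil, X_word_single, X_word, ip_word_single, ip_add_left, ip_smul_left,
    ip_word_of_length_ne, psi_mul, mul_add]
  ring

theorem VacuumTracial.phiTracial {D : FockData B} {hX : ∀ u, D.IsBounded (D.X u)}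
    (h : D.VacuumTracial (D.Gamma hX)) : D.PhiTracial := fun u v => by
  rw [← moment_two, ← moment_two, h.moment_rotate]; rfl

/-- Traciality of the third moments. -/
theorem VacuumTracial.phi_mul_Lambda {D : FockData B} {hX : ∀ u, D.IsBounded (D.X u)}
    (h : D.VacuumTracial (D.Gamma hX)) (a b c : B) :
    D.phi (a * D.Lambda b c) = D.phi (b * D.Lambda c a) := by
  rw [← moment_three, ← moment_three, h.moment_rotate]; rfl

theorem VacuumTracial.traceStar {D : FockData B} {hX : ∀ u, D.IsBounded (D.X u)}
    (h : D.VacuumTracial (D.Gamma hX)) : D.TraceStar := fun u v => D.eq_of_phi_mul fun d => by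
  have := D.phi_Lambda v d (star u)
  rw [star_star] at this
  rw [h.phiTracial, ← this, h.phi_mul_Lambda d, h.phi_mul_Lambda u, h.phi_mul_Lambda v,
    h.phi_mul_Lambda d, h.phi_mul_Lambda u]

/-- Traciality of the fourth moments, together with that of the lower ones. -/
theorem VacuumTracial.traceAssoc {D : FockData B} {hX : ∀ u, D.IsBounded (D.X u)}
    (h : D.VacuumTracial (D.Gamma hX)) : D.TraceAssoc := fun u y v => D.eq_of_phi_mul fun t => by
  have hr := h.moment_rotate t [u, y, v]
  simp only [List.cons_append, List.nil_append, moment_four] at hr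
  have e1 : D.phi (u * D.Lambda y (D.Lambda v t)) = D.phi (t * D.Lambda (D.Lambda u y) v) := by
    rw [← h.phi_mul_Lambda (D.Lambda v t), h.phiTracial, h.phi_mul_Lambda, h.phi_mul_Lambda]
  have e2 : D.phi (u * (D.gamma (y * v) * t)) = D.phi (t * (u * D.gamma (y * v))) := by
    rw [h.phiTracial t, mul_assoc]
  rw [e1, e2, h.phiTracial v t, h.phiTracial u t] at hr
  simp only [mul_sub, map_sub]
  linear_combination -hr

/-- Traciality of the fifth moments: `Λ(u γ[w] ⊗ v) = Λ(u ⊗ γ[w] v)` for products `w`. -/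
theorem VacuumTracial.Lambda_gamma {D : FockData B} {hX : ∀ u, D.IsBounded (D.X u)}
    (h : D.VacuumTracial (D.Gamma hX)) (u y z v : B) :
    D.Lambda u (D.gamma (y * z) * v) = D.Lambda (u * D.gamma (y * z)) v := by
  refine D.eq_of_phi_mul fun t => ?_
  have hτ := h.phiTracial
  have hT := h.phi_mul_Lambda
  have h2 := h.traceAssoc
  have hr := h.moment_rotate t [u, y, z, v]
  simp only [List.cons_append, List.nil_append, moment_five] at hr
  -- cyclicity of `φ[a Λ(b ⊗ c)]` moves the bracketing from the right to the left
  have q1 : D.phi (u * D.Lambda y (D.Lambda z (D.Lambda v t)))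
      = D.phi (t * D.Lambda (D.Lambda (D.Lambda u y) z) v) := by
    rw [← hT (D.Lambda z _), hτ, ← hT (D.Lambda v t), hτ, ← hT t]
  have q2 := h2 u y (D.Lambda z v)
  have q3 := h2 (D.Lambda u y) z v
  have g1 : D.gamma (u * D.Lambda y z) = D.gamma (D.Lambda u y * z) := by
    have := D.gamma_Lambda y z (star u)
    rw [star_star] at this
    rw [this, h.traceStar]
  have q4 := congrArg (fun a => D.phi (t * a)) q2
  have q5 := congrArg (fun a => D.phi (t * a)) q3
  simp only [mul_sub, map_sub] at q4 q5
  have c1 : D.phi (u * (D.gamma (y * D.Lambda z v) * t))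
      = D.phi (t * (u * D.gamma (y * D.Lambda z v))) := by rw [hτ t, mul_assoc]
  have c2 : D.phi (u * (D.gamma (y * z) * D.Lambda v t))
      = D.phi (t * D.Lambda (u * D.gamma (y * z)) v) := by rw [← mul_assoc, hT, hT]
  have c3 : D.phi (u * D.Lambda y (D.gamma (z * v) * t))
      = D.phi (t * (D.Lambda u y * D.gamma (z * v))) := by
    rw [← hT, hτ t, hτ _ (D.Lambda u y), mul_assoc]
  rw [q1, c1, c2, c3, g1, hτ v t, hτ u t] at hr
  linear_combination hr + q4 + q5 - D.phi (y * z) * hT t u v - D.phi (z * v) * hT t u y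
    - D.phi (u * y) * hT t z v

/-- Given `TraceAssoc`, the condition `TraceExtra` is equivalent to the identity of
`VacuumTracial.Lambda_gamma`: expand `Λ(y ⊗ Λ(z ⊗ Λ(w ⊗ u)))` in the different bracketings. -/
theorem VacuumTracial.traceExtra {D : FockData B} {hX : ∀ u, D.IsBounded (D.X u)}
    (h : D.VacuumTracial (D.Gamma hX)) : D.TraceExtra := by
  intro y z w u
  have h2 := h.traceAssoc
  have g : ∀ a b c, D.gamma (a * D.Lambda b c) = D.gamma (D.Lambda a b * c) := fun a b c => by
    have := D.gamma_Lambda b c (star a)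
    rw [star_star] at this
    rw [this, h.traceStar]
  have a1 := congrArg (D.Lambda y) (h2 z w u)
  have a2 := h2 y z (D.Lambda w u)
  have a3 := h2 (D.Lambda y z) w u
  have a4 := h2 y (D.Lambda z w) u
  have a5 := congrArg (fun a => D.Lambda a u) (h2 y z w)
  have a6 := h.Lambda_gamma y z w u
  simp only [map_sub, LinearMap.sub_apply] at a1 a5
  rw [← g] at a3
  rw [g z w u] at a2
  linear_combination (norm := abel) a1 - a2 - a3 + a4 + a5 + a6

end FockData

/-! ### Conjugations and von Neumann algebras -/

section Conjugation

variable {H : Type*} [NormedAddCommGroup H] [InnerProductSpace ℂ H] [CompleteSpace H]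

/-- `J` is an antiunitary involution that fixes the vector `Ω`. -/
structure IsConjugation (J : H ≃ₗᵢ⋆[ℂ] H) (Ω : H) : Prop where
  involutive : ∀ x, J (J x) = x
  inner_map_map : ∀ x y, inner ℂ (J x) (J y) = inner ℂ y x
  map_vec : J Ω = Ω

/-- The linear operator `J A* J`. -/
def antiConj (J : H ≃ₗᵢ⋆[ℂ] H) (A : H →L[ℂ] H) : H →L[ℂ] H :=
  (J.toContinuousLinearEquiv : H →SL[starRingEnd ℂ] H).comp
    ((star A).comp (J.toContinuousLinearEquiv : H →SL[starRingEnd ℂ] H))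

theorem antiConj_apply (J : H ≃ₗᵢ⋆[ℂ] H) (A : H →L[ℂ] H) (x : H) :
    antiConj J A x = J (star A (J x)) := rfl

theorem antiConj_add (J : H ≃ₗᵢ⋆[ℂ] H) (A C : H →L[ℂ] H) :
    antiConj J (A + C) = antiConj J A + antiConj J C := by
  ext x; simp [antiConj_apply]

theorem antiConj_smul (J : H ≃ₗᵢ⋆[ℂ] H) (c : ℂ) (A : H →L[ℂ] H) :
    antiConj J (c • A) = c • antiConj J A := by
  ext x
  rw [antiConj_apply, star_smul, smul_apply, smul_apply, antiConj_apply]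
  exact (J.map_smulₛₗ _ _).trans (by simp)

theorem inner_star_left (A : H →L[ℂ] H) (x y : H) : inner ℂ (star A x) y = inner ℂ x (A y) :=
  ContinuousLinearMap.adjoint_inner_left A y x

theorem inner_star_right (A : H →L[ℂ] H) (x y : H) : inner ℂ x (star A y) = inner ℂ (A x) y :=
  ContinuousLinearMap.adjoint_inner_right A x y

namespace IsConjugation

variable {J : H ≃ₗᵢ⋆[ℂ] H} {Ω : H}

theorem inner_map_left (hJ : IsConjugation J Ω) (x y : H) :
    inner ℂ (J x) y = inner ℂ (J y) x := by
  have := hJ.inner_map_map x (J y)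
  rwa [hJ.involutive] at this

theorem inner_map_right (hJ : IsConjugation J Ω) (x y : H) :
    inner ℂ x (J y) = inner ℂ y (J x) := by
  have := hJ.inner_map_map (J x) y
  rwa [hJ.involutive] at this

theorem antiConj_mul (hJ : IsConjugation J Ω) (A C : H →L[ℂ] H) :
    antiConj J (A * C) = antiConj J C * antiConj J A := by
  ext x; simp [antiConj_apply, hJ.involutive]

theorem antiConj_one (hJ : IsConjugation J Ω) : antiConj J 1 = 1 := by
  ext x; simp [antiConj_apply, hJ.involutive]

theorem star_antiConj (hJ : IsConjugation J Ω) (A : H →L[ℂ] H) :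
    star (antiConj J A) = antiConj J (star A) := by
  refine ContinuousLinearMap.ext fun y => ext_inner_left ℂ fun x => ?_
  rw [inner_star_right, antiConj_apply, antiConj_apply, star_star, hJ.inner_map_left,
    inner_star_right, hJ.inner_map_right]

theorem antiConj_antiConj (hJ : IsConjugation J Ω) (A : H →L[ℂ] H) :
    antiConj J (antiConj J A) = A := by
  ext x
  rw [antiConj_apply, hJ.star_antiConj, antiConj_apply, star_star, hJ.involutive, hJ.involutive]

variable {M : VonNeumannAlgebra H}

/-- The operators `A` in `M` with `J A Ω = A* Ω` for which `J A* J` lies in the commutant. The second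
condition makes the first one stable under products. -/
def algebra (hJ : IsConjugation J Ω) (M : VonNeumannAlgebra H) :
    Subalgebra ℂ (H →L[ℂ] H) where
  carrier := {A | A ∈ M ∧ J (A Ω) = star A Ω ∧ antiConj J A ∈ M.commutant}
  mul_mem' := by
    rintro A C ⟨hA, hA1, hA2⟩ ⟨hC, hC1, hC2⟩
    refine ⟨mul_mem hA hC, ?_, ?_⟩
    -- `J A J` is the adjoint of `J A* J`, so it commutes with `C*`
    · have h1 := VonNeumannAlgebra.mem_commutant_iff.1 (star_mem hA2) (star C) (star_mem hC)
      have h2 := DFunLike.congr_fun h1 Ω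
      simp only [mul_apply_eq_comp, hJ.star_antiConj, antiConj_apply, star_star, hJ.map_vec, hA1]
        at h2
      rw [star_mul, mul_apply_eq_comp, mul_apply_eq_comp, h2, ← hC1, hJ.involutive]
    · rw [hJ.antiConj_mul]
      exact mul_mem hC2 hA2
  add_mem' := by
    rintro A C ⟨hA, hA1, hA2⟩ ⟨hC, hC1, hC2⟩
    refine ⟨add_mem hA hC, ?_, ?_⟩
    · rw [add_apply, map_add, hA1, hC1, star_add, add_apply]
    · rw [antiConj_add]
      exact add_mem hA2 hC2
  algebraMap_mem' c := by
    have h : algebraMap ℂ (H →L[ℂ] H) c = c • 1 := Algebra.algebraMap_eq_smul_one c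
    refine ⟨M.toStarSubalgebra.algebraMap_mem c, ?_, ?_⟩
    · rw [h, star_smul, smul_apply, smul_apply, star_one]
      exact (J.map_smulₛₗ _ _).trans (by simp [hJ.map_vec])
    · rw [h, antiConj_smul, hJ.antiConj_one, ← h]
      exact M.commutant.toStarSubalgebra.algebraMap_mem c

/-- The relation `J A Ω = A* Ω` passes from a subalgebra with dense orbit of `Ω` to the whole von
Neumann algebra. -/
theorem map_apply_vec (hJ : IsConjugation J Ω)
    (hd : Dense {x : H | ∃ A ∈ hJ.algebra M, x = A Ω}) {A : H →L[ℂ] H} (hA : A ∈ M) :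
    J (A Ω) = star A Ω := by
  refine hd.eq_of_inner_left ℂ ?_
  rintro _ ⟨C, ⟨-, hC1, hC2⟩, rfl⟩
  have h1 : C Ω = antiConj J C Ω := by
    rw [antiConj_apply, hJ.map_vec, ← hC1, hJ.involutive]
  have h2 : star (antiConj J C) Ω = J (C Ω) := by
    rw [hJ.star_antiConj, antiConj_apply, star_star, hJ.map_vec]
  -- `C Ω` is also the image of `Ω` under `J C* J`, which commutes with `A`
  rw [hJ.inner_map_left, ← h2, inner_star_left, inner_star_left, h1]
  exact congrArg (fun T : H →L[ℂ] H => inner ℂ Ω (T Ω))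
    (VonNeumannAlgebra.mem_commutant_iff.1 hC2 A hA).symm

/-- If `J A Ω = A* Ω` on `M` and `M Ω` is dense, then `J M J` is contained in the commutant. -/
theorem antiConj_mem_commutant (hJ : IsConjugation J Ω) (hd : Dense {x : H | ∃ A ∈ M, x = A Ω})
    (hM : ∀ A ∈ M, J (A Ω) = star A Ω) {A : H →L[ℂ] H} (hA : A ∈ M) :
    antiConj J A ∈ M.commutant := by
  refine VonNeumannAlgebra.mem_commutant_iff.2 fun C hC => ?_
  refine DFunLike.coe_injective (Continuous.ext_on hd (by fun_prop) (by fun_prop) ?_)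
  rintro _ ⟨E, hE, rfl⟩
  have h : ∀ E ∈ M, antiConj J A (E Ω) = E (A Ω) := fun E hE => by
    rw [antiConj_apply, hM E hE, ← mul_apply_eq_comp, ← star_mul, ← hM _ (mul_mem hE hA),
      hJ.involutive, mul_apply_eq_comp]
  rw [mul_apply_eq_comp, mul_apply_eq_comp, h E hE]
  exact (h (C * E) (mul_mem hC hE)).symm

/-- The relation `J A Ω = A* Ω` on `M` passes to the commutant, so that `M` and its commutant play
symmetric roles. -/
theorem map_apply_vec_commutant (hJ : IsConjugation J Ω)
    (hd : Dense {x : H | ∃ A ∈ M, x = A Ω}) (hM : ∀ A ∈ M, J (A Ω) = star A Ω)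
    {T : H →L[ℂ] H} (hT : T ∈ M.commutant) : J (T Ω) = star T Ω := by
  refine hd.eq_of_inner_left ℂ ?_
  rintro _ ⟨A, hA, rfl⟩
  rw [hJ.inner_map_left, hM A hA, inner_star_left, inner_star_left, ← mul_apply_eq_comp,
    VonNeumannAlgebra.mem_commutant_iff.1 hT A hA, mul_apply_eq_comp]

theorem dense_commutant (hJ : IsConjugation J Ω) (hd : Dense {x : H | ∃ A ∈ M, x = A Ω})
    (hM : ∀ A ∈ M, J (A Ω) = star A Ω) : Dense {x : H | ∃ T ∈ M.commutant, x = T Ω} := by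
  refine hd.mono ?_
  rintro _ ⟨A, hA, rfl⟩
  refine ⟨antiConj J A, hJ.antiConj_mem_commutant hd hM hA, ?_⟩
  rw [antiConj_apply, hJ.map_vec, ← hM A hA, hJ.involutive]

/-- The reverse inclusion: apply `antiConj_mem_commutant` to the commutant. -/
theorem antiConj_mem (hJ : IsConjugation J Ω) (hd : Dense {x : H | ∃ A ∈ M, x = A Ω})
    (hM : ∀ A ∈ M, J (A Ω) = star A Ω) {T : H →L[ℂ] H} (hT : T ∈ M.commutant) :
    antiConj J T ∈ M := by
  rw [← M.commutant_commutant]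
  exact hJ.antiConj_mem_commutant (hJ.dense_commutant hd hM)
    (fun T hT => hJ.map_apply_vec_commutant hd hM hT) hT

theorem eq_zero_of_apply_vec (hJ : IsConjugation J Ω) (hd : Dense {x : H | ∃ A ∈ M, x = A Ω})
    (hM : ∀ A ∈ M, J (A Ω) = star A Ω) {A : H →L[ℂ] H} (hA : A ∈ M) (h : A Ω = 0) : A = 0 := by
  refine DFunLike.coe_injective (Continuous.ext_on (hJ.dense_commutant hd hM) (by fun_prop)
    (by fun_prop) ?_)
  rintro _ ⟨T, hT, rfl⟩
  rw [← mul_apply_eq_comp, VonNeumannAlgebra.mem_commutant_iff.1 hT A hA, mul_apply_eq_comp, h,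
    map_zero, zero_apply]

theorem inner_mul_comm (hJ : IsConjugation J Ω) (hM : ∀ A ∈ M, J (A Ω) = star A Ω)
    {A C : H →L[ℂ] H} (hA : A ∈ M) (hC : C ∈ M) :
    inner ℂ Ω ((A * C) Ω) = inner ℂ Ω ((C * A) Ω) := by
  rw [mul_apply_eq_comp, mul_apply_eq_comp, ← inner_star_left A, ← hM A hA, hJ.inner_map_left,
    hM C hC, inner_star_left]

theorem isModularConjugation (hJ : IsConjugation J Ω) (hd : Dense {x : H | ∃ A ∈ M, x = A Ω})
    (hM : ∀ A ∈ M, J (A Ω) = star A Ω) : IsModularConjugation M Ω J where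
  cyclic := hd
  separating A hA h := hJ.eq_zero_of_apply_vec hd hM hA h
  polar := by
    -- in the tracial case the modular operator is the identity
    refine ⟨((ContinuousLinearMap.id ℂ H : H →L[ℂ] H) : H →ₗ[ℂ] H).toPMap ⊤, ?_, fun x => ?_, ?_⟩
    · rw [LinearPMap.isSelfAdjoint_def,
        ContinuousLinearMap.toPMap_adjoint_eq_adjoint_toPMap_of_dense _ (by simp)]
      congr 2
      exact ContinuousLinearMap.adjoint_id
    · exact inner_self_nonneg (𝕜 := ℂ)
    · have h1 : {p : H × H | ∃ A ∈ M, p = (A Ω, star A Ω)}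
          = (fun x => (x, J x)) '' {x : H | ∃ A ∈ M, x = A Ω} := by
        ext p
        constructor
        · rintro ⟨A, hA, rfl⟩
          exact ⟨A Ω, ⟨A, hA, rfl⟩, by simp [hM A hA]⟩
        · rintro ⟨_, ⟨A, hA, rfl⟩, rfl⟩
          exact ⟨A, hA, by simp [hM A hA]⟩
      have h2 : {p : H × H | ∃ x : (((ContinuousLinearMap.id ℂ H : H →L[ℂ] H) :
            H →ₗ[ℂ] H).toPMap ⊤).domain,
          p = ((x : H), J (((ContinuousLinearMap.id ℂ H : H →L[ℂ] H) :
            H →ₗ[ℂ] H).toPMap ⊤ x))} = {p : H × H | J p.1 = p.2} := by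
        ext p
        constructor
        · rintro ⟨x, rfl⟩
          rfl
        · exact fun h => ⟨⟨p.1, trivial⟩, Prod.ext rfl (Eq.symm h)⟩
      rw [h1, h2]
      have hJc : Continuous J := J.continuous
      refine subset_antisymm (closure_minimal ?_ (isClosed_eq (by fun_prop) (by fun_prop))) ?_
      · rintro _ ⟨x, -, rfl⟩
        rfl
      · intro p hp
        have : p = (fun x => (x, J x)) p.1 := Prod.ext rfl (Eq.symm hp)
        rw [this]
        exact image_closure_subset_closure_image (by fun_prop) ⟨p.1, hd p.1, rfl⟩

/-- The anti-isomorphism `A ↦ J A* J` of a von Neumann algebra onto its commutant. -/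
def antiEquiv (hJ : IsConjugation J Ω) (hd : Dense {x : H | ∃ A ∈ M, x = A Ω})
    (hM : ∀ A ∈ M, J (A Ω) = star A Ω) :
    M.toStarSubalgebra ≃⋆ₐ[ℂ] (M.commutant.toStarSubalgebra)ᵐᵒᵖ where
  toFun A := MulOpposite.op ⟨antiConj J A, hJ.antiConj_mem_commutant hd hM A.2⟩
  invFun T := ⟨antiConj J T.unop, hJ.antiConj_mem hd hM T.unop.2⟩
  left_inv _ := Subtype.ext (hJ.antiConj_antiConj _)
  right_inv _ := MulOpposite.unop_injective (Subtype.ext (hJ.antiConj_antiConj _))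
  map_mul' _ _ := MulOpposite.unop_injective (Subtype.ext (hJ.antiConj_mul _ _))
  map_add' _ _ := MulOpposite.unop_injective (Subtype.ext (antiConj_add J _ _))
  map_star' _ := MulOpposite.unop_injective (Subtype.ext (hJ.star_antiConj _).symm)
  map_smul' c _ := MulOpposite.unop_injective (Subtype.ext (antiConj_smul J c _))

end IsConjugation

end Conjugation

namespace FockData

open AlgFock

variable {B : Type*} [Ring B] [StarRing B] [Algebra ℂ B] [StarModule ℂ B] (D : FockData B)
variable (hX : ∀ u, D.IsBounded (D.X u))

/-! ### Wick polynomials -/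

/-- `W(u_1, ..., u_n) Ω = u_1 ⊗ ... ⊗ u_n`: the recursion subtracts exactly the annihilation and
preservation terms of `X(u_1)`. -/
theorem wick_apply_Omega (l : List B) : D.wick (D.XOp hX) l D.Omega = D.toFock (word l) := by
  have alg : ∀ (c : ℂ) (x : D.Fock), algebraMap ℂ (D.Fock →L[ℂ] D.Fock) c x = c • x :=
    fun c x => rfl
  induction l using FockData.wick.induct D with
  | case1 => rw [wick, word_nil]; rfl
  | case2 u => rw [wick, Omega, ← word_nil, XOp_toFock, X_word_nil]
  | case3 u v =>
    rw [wick, sub_apply, sub_apply, mul_apply_eq_comp, alg, Omega, ← word_nil, XOp_toFock,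
      XOp_toFock, XOp_toFock, X_word_nil, X_word_nil, X_word_single, map_add, map_add, map_smul]
    abel
  | case4 u v w l h1 h2 h3 =>
    rw [wick, sub_apply, sub_apply, mul_apply_eq_comp, h1, h2, h3, XOp_toFock, X_word, map_add,
      map_add]
    abel

theorem wick_mem {A : Type*} [Ring A] [Algebra ℂ A] (P : Subalgebra ℂ A) {X : B → A}
    (h : ∀ u, X u ∈ P) (l : List B) : D.wick X l ∈ P := by
  induction l using FockData.wick.induct D with
  | case1 => rw [wick]; exact one_mem P
  | case2 u => rw [wick]; exact h u
  | case3 u v =>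
    rw [wick]
    exact sub_mem (sub_mem (mul_mem (h u) (h v)) (h _)) (P.algebraMap_mem _)
  | case4 u v w l h1 h2 h3 =>
    rw [wick]
    exact sub_mem (sub_mem (mul_mem (h u) h1) h2) h3

/-- The orbit of the vacuum under an algebra containing all `X(u)` is dense. -/
theorem dense_orbit (P : Subalgebra ℂ (D.Fock →L[ℂ] D.Fock)) (h : ∀ u, D.XOp hX u ∈ P) :
    Dense {x : D.Fock | ∃ A ∈ P, x = A D.Omega} := by
  refine D.denseRange_toFock.mono ?_
  rintro _ ⟨x, rfl⟩
  induction x using word_induction with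
  | hs c l =>
    exact ⟨c • D.wick (D.XOp hX) l, P.smul_mem (D.wick_mem P h l) c, by
      rw [smul_apply, wick_apply_Omega, map_smul]⟩
  | h0 => exact ⟨0, P.zero_mem, by simp⟩
  | ha x y hx hy =>
    obtain ⟨A, hA, hx⟩ := hx
    obtain ⟨C, hC, hy⟩ := hy
    exact ⟨A + C, P.add_mem hA hC, by rw [map_add, hx, hy, add_apply]⟩

/-! ### The modular conjugation in the tracial case -/

theorem norm_S (hφ : D.PhiTracial) (hγ : D.GammaSymmetric) (x : AlgFock B) :
    ‖D.toFock (S B x)‖ = ‖D.toFock x‖ := by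
  rw [@norm_eq_sqrt_re_inner ℂ, @norm_eq_sqrt_re_inner ℂ, inner_toFock, inner_toFock,
    D.ip_S hφ hγ]

/-- The extension of `S` to the Fock space, as a continuous antilinear map. It is a junk value unless
`S` is bounded for the seminorm, as it is in the tracial case by `norm_S`. -/
def extS : D.Fock →SL[starRingEnd ℂ] D.Fock :=
  (D.toFock.comp (S B)).extendOfNorm D.toFock

theorem extS_toFock (hφ : D.PhiTracial) (hγ : D.GammaSymmetric) (x : AlgFock B) :
    D.extS (D.toFock x) = D.toFock (S B x) :=
  LinearMap.extendOfNorm_eq D.denseRange_toFock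
    ⟨1, fun x => by rw [one_mul]; exact (D.norm_S hφ hγ x).le⟩ x

theorem extS_extS (hφ : D.PhiTracial) (hγ : D.GammaSymmetric) (x : D.Fock) :
    D.extS (D.extS x) = x := by
  have : D.extS.comp D.extS = ContinuousLinearMap.id ℂ D.Fock :=
    D.clm_ext fun x => by simp [D.extS_toFock hφ hγ, S_S]
  exact DFunLike.congr_fun this x

/-- The extension of `S` to the Fock space, as an antiunitary operator. -/
def conjugation (hφ : D.PhiTracial) (hγ : D.GammaSymmetric) : D.Fock ≃ₗᵢ⋆[ℂ] D.Fock where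
  toLinearEquiv := LinearEquiv.ofInvolutive (D.extS : D.Fock →ₛₗ[starRingEnd ℂ] D.Fock)
    (D.extS_extS hφ hγ)
  norm_map' x := by
    change ‖D.extS x‖ = ‖x‖
    refine D.denseRange_toFock.induction_on (p := fun x => ‖D.extS x‖ = ‖x‖) x
      (isClosed_eq (by fun_prop) (by fun_prop)) fun x => ?_
    rw [D.extS_toFock hφ hγ, D.norm_S hφ hγ]

theorem conjugation_toFock (hφ : D.PhiTracial) (hγ : D.GammaSymmetric) (x : AlgFock B) :
    D.conjugation hφ hγ (D.toFock x) = D.toFock (S B x) := D.extS_toFock hφ hγ x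

theorem isConjugation (hφ : D.PhiTracial) (hγ : D.GammaSymmetric) :
    IsConjugation (D.conjugation hφ hγ) D.Omega where
  involutive := D.extS_extS hφ hγ
  inner_map_map x y := by
    have hc := (D.conjugation hφ hγ).continuous
    refine D.denseRange_toFock.induction_on₂ (p := fun x y =>
      inner ℂ (D.conjugation hφ hγ x) (D.conjugation hφ hγ y) = inner ℂ y x)
      (isClosed_eq (by fun_prop) (by fun_prop)) (fun x y => ?_) x y
    rw [conjugation_toFock, conjugation_toFock, inner_toFock, inner_toFock, D.ip_S hφ hγ]
  map_vec := by
    rw [Omega, conjugation_toFock, ← word_nil, S_word]; rfl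

theorem isBounded_Xr (hX : ∀ u, D.IsBounded (D.X u)) (hφ : D.PhiTracial)
    (hγ : D.GammaSymmetric) (u : B) : D.IsBounded (D.Xr u) := by
  obtain ⟨C, hC⟩ := hX (star u)
  refine ⟨C, fun x => ?_⟩
  have : D.Xr u x = S B (D.X (star u) (S B x)) := rfl
  rw [this, D.norm_S hφ hγ, ← D.norm_S hφ hγ x]
  exact hC _

theorem antiConj_XOp_toFock (hφ : D.PhiTracial) (hγ : D.GammaSymmetric) (u : B) (x : AlgFock B) :
    antiConj (D.conjugation hφ hγ) (D.XOp hX u) (D.toFock x) = D.toFock (D.Xr u x) := by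
  rw [antiConj_apply, star_XOp, conjugation_toFock, XOp_toFock, conjugation_toFock]
  rfl

theorem RightCommutes.XOp_mem_algebra {D : FockData B} (hX : ∀ u, D.IsBounded (D.X u))
    (hφ : D.PhiTracial) (h : D.RightCommutes) (u : B) :
    D.XOp hX u ∈ (D.isConjugation hφ h.gammaSymmetric).algebra (D.Gamma hX) := by
  refine ⟨D.XOp_mem_Gamma hX u, ?_, (D.mem_commutant_Gamma_iff hX).2 fun v => D.clm_ext fun x => ?_⟩
  · rw [star_XOp, Omega, ← word_nil, XOp_toFock, conjugation_toFock, XOp_toFock, X_word_nil,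
      X_word_nil, S_word]
    rfl
  · rw [mul_apply_eq_comp, mul_apply_eq_comp, antiConj_XOp_toFock, XOp_toFock, XOp_toFock,
      antiConj_XOp_toFock, h]

theorem dense_Gamma :
    Dense {x : D.Fock | ∃ A ∈ D.Gamma hX, x = A D.Omega} :=
  D.dense_orbit hX (D.Gamma hX).toStarSubalgebra.toSubalgebra (D.XOp_mem_Gamma hX)

theorem RightCommutes.conjugation_apply_Omega {D : FockData B} (hX : ∀ u, D.IsBounded (D.X u))
    (hφ : D.PhiTracial) (h : D.RightCommutes) (A : D.Fock →L[ℂ] D.Fock) (hA : A ∈ D.Gamma hX) :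
    D.conjugation hφ h.gammaSymmetric (A D.Omega) = star A D.Omega :=
  (D.isConjugation hφ h.gammaSymmetric).map_apply_vec
    (D.dense_orbit hX _ (h.XOp_mem_algebra hX hφ)) hA

/-- Both sides give the same vector `u_n* ⊗ ... ⊗ u_1*` on the vacuum, which is separating. -/
theorem RightCommutes.star_wick {D : FockData B} (hX : ∀ u, D.IsBounded (D.X u))
    (hφ : D.PhiTracial) (h : D.RightCommutes) (l : List B) :
    star (D.wick (D.XOp hX) l) = D.wick (D.XOp hX) (l.map star).reverse := by
  have hm : ∀ l, D.wick (D.XOp hX) l ∈ D.Gamma hX := fun l =>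
    D.wick_mem (D.Gamma hX).toStarSubalgebra.toSubalgebra (D.XOp_mem_Gamma hX) l
  rw [← sub_eq_zero]
  refine (D.isConjugation hφ h.gammaSymmetric).eq_zero_of_apply_vec (D.dense_Gamma hX)
    (h.conjugation_apply_Omega hX hφ) (sub_mem (star_mem (hm l)) (hm _)) ?_
  rw [sub_apply, ← h.conjugation_apply_Omega hX hφ _ (hm l), wick_apply_Omega, wick_apply_Omega,
    conjugation_toFock, S_word, sub_self]

end FockData

end

theorem mainTheorem6 {B : Type*} [Ring B] [StarRing B] [Algebra ℂ B] [StarModule ℂ B]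
    (D : FockData B) (hX : ∀ u, D.IsBounded (D.X u)) :
    -- the algebra is also generated by the operators with self-adjoint argument
    D.Gamma hX = vonNeumannGen (D.XOp hX '' {u | star u = u}) ∧
    -- (a)
    (D.RightCommutes ↔ D.TraceStar ∧ D.TraceAssoc ∧ D.TraceExtra ∧ D.GammaSymmetric) ∧
    (D.RightCommutes → ∀ u, D.ClosureCommutes (D.Gamma hX) (D.Xr u)) ∧
    ((∀ u, D.IsClosable (D.Xr u)) → (∀ u, D.ClosureCommutes (D.Gamma hX) (D.Xr u)) →
      D.RightCommutes) ∧
    ((∀ u, ∃ c : ℂ, D.gamma u = algebraMap ℂ B c) → D.TraceExtra) ∧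
    -- (b)
    (D.PhiTracial → D.RightCommutes → D.VacuumTracial (D.Gamma hX)) ∧
    -- (c)
    (D.VacuumTracial (D.Gamma hX) → D.TraceStar ∧ D.TraceAssoc ∧ D.TraceExtra) ∧
    -- under the assumptions in (b)
    (D.PhiTracial → D.RightCommutes →
      ∃ J : D.Fock ≃ₗᵢ⋆[ℂ] D.Fock,
        (∀ x, J (D.toFock x) = D.toFock (AlgFock.S B x)) ∧
        IsModularConjugation (D.Gamma hX) D.Omega J ∧
        (∀ l : List B, star (D.wick (D.XOp hX) l) = D.wick (D.XOp hX) (l.map star).reverse) ∧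
        ∃ hXr : ∀ u, D.IsBounded (D.Xr u),
          (∀ u, star (D.ext (D.Xr u) (hXr u)) = D.ext (D.Xr (star u)) (hXr (star u))) ∧
          ∃ Θ : (D.Gamma hX).toStarSubalgebra ≃⋆ₐ[ℂ]
              ((D.Gamma hX).commutant.toStarSubalgebra)ᵐᵒᵖ,
            (∀ (A : (D.Gamma hX).toStarSubalgebra) (ξ : D.Fock),
              ((Θ A).unop : D.Fock →L[ℂ] D.Fock) ξ
                = J (star (A : D.Fock →L[ℂ] D.Fock) (J ξ))) ∧
            (∀ u : B, ((Θ ⟨D.XOp hX u, D.XOp_mem_Gamma hX u⟩).unop : D.Fock →L[ℂ] D.Fock)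
                = D.ext (D.Xr u) (hXr u))) := by
  refine ⟨D.Gamma_eq_selfAdjoint hX, D.rightCommutes_iff, fun h u => h.closureCommutes hX u,
    D.rightCommutes_of_closureCommutes hX, D.traceExtra_of_scalar,
    fun hφ h A hA C hC => ?_, fun h => ⟨h.traceStar, h.traceAssoc, h.traceExtra⟩, fun hφ h => ?_⟩
  · exact (D.isConjugation hφ h.gammaSymmetric).inner_mul_comm
      (h.conjugation_apply_Omega hX hφ) hA hC
  · have hJ := D.isConjugation hφ h.gammaSymmetric
    have hd := D.dense_Gamma hX
    have hM := h.conjugation_apply_Omega hX hφ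
    have hXr := D.isBounded_Xr hX hφ h.gammaSymmetric
    have hr : ∀ u, antiConj (D.conjugation hφ h.gammaSymmetric) (D.XOp hX u)
        = D.ext (D.Xr u) (hXr u) := fun u => D.clm_ext fun x => by
      rw [D.antiConj_XOp_toFock, D.ext_toFock]
    refine ⟨D.conjugation hφ h.gammaSymmetric, D.conjugation_toFock hφ h.gammaSymmetric,
      hJ.isModularConjugation hd hM, h.star_wick hX hφ, hXr, fun u => ?_,
      hJ.antiEquiv hd hM, fun A ξ => rfl, hr⟩
    rw [← hr, ← hr, hJ.star_antiConj, D.star_XOp]
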